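/- **Setting.** Let $l>0$. Two elastic half-planes, the upper one with Lamé constants $\lambda_1,\mu_1$ and the lower one with $\lambda_2,\mu_2$ ($\mu_k>0$, $\lambda_k+\mu_k>0$), are bonded along $|x|>l$ of their common boundary line and have a crack on $|x|<l$. Put $$\alpha_k=\frac{2\mu_k^2}{\lambda_k+3\mu_k},\qquad \beta_k=\frac{2\mu_k(\lambda_k+2\mu_k)}{(\lambda_k+3\mu_k)\pi},$$ and assume $\alpha_1\neq\alpha_2$. Given are real surface tension constants $\gamma_0^{\pm},\gamma_0^{i},\gamma_1^{\pm},\gamma_1^{i}$, stresses $\sigma,\tau$ at infinity, and crack loads $f^\pm$ (continuous on $[-l,l]$) and $g^{\pm}$ (Hölder continuous on $[-l,l]$). The unknown real functions are $\varphi_1,\varphi_2,\psi_1,\psi_2$ on $|x|<l$ and $\varphi,\psi$ on $|x|>l$. Let $u_{1,1}^{\pm}$ be equal to $\varphi_1$ (sign $+$), $\varphi_2$ (sign $-$) for $|x|<l$ and to $\varphi$ for $|x|>l$; let $u_{2,1}^{\pm}$ be equal to $\psi_1$ ($+$), $\psi_2$ ($-$) for $|x|<l$ and to $\psi$ for $|x|>l$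 (the homogeneous field at infinity has been subtracted from the displacements). Define the total boundary stresses by the Dirichlet-to-Neumann formulas $$\sigma_{12}^{+}=\alpha_1u_{2,1}^{+}+\beta_1\int_{\mathbb R}\frac{u_{1,1}^{+}(r)\,dr}{r-x}+\tau,\qquad \sigma_{22}^{+}=-\alpha_1u_{1,1}^{+}+\beta_1\int_{\mathbb R}\frac{u_{2,1}^{+}(r)\,dr}{r-x}+\sigma,$$ $$\sigma_{12}^{-}=\alpha_2u_{2,1}^{-}-\beta_2\int_{\mathbb R}\frac{u_{1,1}^{-}(r)\,dr}{r-x}+\tau,\qquad \sigma_{22}^{-}=-\alpha_2u_{1,1}^{-}-\beta_2\int_{\mathbb R}\frac{u_{2,1}^{-}(r)\,dr}{r-x}+\sigma,$$ with Cauchy principal values at $r=x$ (and absolute convergence away from $r=x$). A *solution* consists of six such functions for which these principal values exist for all $|x|\ne l$, with $\psi_1,\psi_2,\psi$ twice differentiable off the tips $\pm l$, and with $$\sigma_{12}^+=\gamma_1^+\psi_1''+f^+,\quad \sigma_{22}^+=-\gamma_0^+\psi_1'+g^+,\quad \sigma_{12}^-=-\gamma_1^-\psi_2''+f^-,\quad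 \sigma_{22}^-=\gamma_0^-\psi_2'+g^-\qquad(|x|<l),$$ $$\sigma_{12}^+-\sigma_{12}^-=\gamma_1^i\psi'',\qquad \sigma_{22}^+-\sigma_{22}^-=-\gamma_0^i\psi'\qquad(|x|>l).$$ Below, $p\in\{l,-l\}$ is a tip, $r=|x-p|$, and limits $x\to p$ are taken within the domain of the function concerned. A real function $F$ *has an integrable power singularity* at $p$ if for some $\gamma,A\in\mathbb C$ with $-1<\operatorname{Re}\gamma\le 0$, $\gamma\ne0$ and $\operatorname{Re}(A\rho^{\gamma})$ not identically zero in $\rho>0$, $$F(x)=\operatorname{Re}(A r^{\gamma})+o(r^{\operatorname{Re}\gamma}),\qquad x\to p .$$ This includes $r^{-1/2}$, the oscillatory $r^{-1/2+i\varepsilon}$, and purely imaginary exponents. **Claim.** Let $\gamma_1^{+},\gamma_1^{-},\gamma_1^{i}$ all be nonzero, and consider a solution for which, at both tips, each of $\varphi_1,\varphi_2,\varphi,\psi_1'',\psi_2'',\psi''$ is $O(r^{s})$ for some real $s>-1$ (which may depend on the function and the tip). Then at each tip $p=\pm l$: 1. None of $\varphi_1,\varphi_2,\varphi$, $\psi_1,\psi_2,\psi$,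 $\psi_1'',\psi_2'',\psi''$, and none of the stresses $\sigma_{12}^{\pm},\sigma_{22}^{\pm}$ (as $x\to p$ along the crack $|x|<l$ or along the bonded interface $|x|>l$) has an integrable power singularity. 2. The singularities are at most logarithmic. Each $\varphi_k\in\{\varphi_1,\varphi_2,\varphi\}$ (that is, $u_{1,1}^\pm$) satisfies $$\varphi_k(x)=A_k\ln r+c_k+o(1),$$ and each $\psi_k''\in\{\psi_1'',\psi_2'',\psi''\}$ satisfies $$\psi_k''(x)=B_k\ln^2 r+C_k\ln r+d_k+o(1),$$ with real coefficients; $\sigma_{12}^{\pm}$ has expansions of the latter form both along the crack and along the bonded interface. 3. The functions $\psi_1,\psi_2,\psi$ (that is, $u_{2,1}^{\pm}$) and $\psi_1',\psi_2',\psi'$ are bounded near $p$. On the crack, $\sigma_{22}^{+}$ and $\sigma_{22}^{-}$ are bounded near $p$. On the bonded interface the jump $\sigma_{22}^+-\sigma_{22}^-$ is bounded near $p$, and $\sigma_{22}^{+},\sigma_{22}^{-}$ each have the form $A\ln r+c+o(1)$. -/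

import Mathlib

open Filter Topology MeasureTheory Asymptotics
open scoped NNReal

noncomputable section

namespace InterfaceCrack

/-! ### Cauchy principal values on the line -/

/-- The truncated Cauchy integral `∫_{|r - x| > ε} u(r) / (r - x) dr`. -/
def truncatedCauchy (u : ℝ → ℝ) (x ε : ℝ) : ℝ :=
  ∫ r in {r : ℝ | ε < |r - x|}, u r / (r - x)

/-- The Cauchy principal value integral of `u(r) / (r - x)` over the line exists: the integrand is
integrable away from `x` (in particular at infinity), and the truncated integrals converge. -/
def CauchyPVExists (u : ℝ → ℝ) (x : ℝ) : Prop :=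
  (∀ ε : ℝ, 0 < ε → IntegrableOn (fun r => u r / (r - x)) {r : ℝ | ε < |r - x|}) ∧
    ∃ v : ℝ, Tendsto (truncatedCauchy u x) (𝓝[>] 0) (𝓝 v)

/-- The Cauchy principal value `p.v. ∫ u(r) / (r - x) dr` (meaningful when `CauchyPVExists u x`). -/
def cauchyPV (u : ℝ → ℝ) (x : ℝ) : ℝ :=
  limUnder (𝓝[>] (0 : ℝ)) (truncatedCauchy u x)

/-! ### Data and unknowns -/

/-- An isotropic linearly elastic material, given by its Lamé constant `lam` and its shear
modulus `mu`. -/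
structure Material where
  lam : ℝ
  mu : ℝ

namespace Material

/-- Poisson's ratio is `lam / (2 * (lam + mu))`; if `0 < mu`, every Poisson's ratio in `(-1, 1/2)`
satisfies these conditions. -/
structure Admissible (m : Material) : Prop where
  mu_pos : 0 < m.mu
  lam_add_mu_pos : 0 < m.lam + m.mu

/-- The coefficient `α = 2 μ² / (λ + 3 μ)` of the Dirichlet-to-Neumann map of a half-plane. -/
def alpha (m : Material) : ℝ := 2 * m.mu ^ 2 / (m.lam + 3 * m.mu)

/-- The coefficient `β = 2 μ (λ + 2 μ) / ((λ + 3 μ) π)` of the Dirichlet-to-Neumann map. -/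
def beta (m : Material) : ℝ :=
  2 * m.mu * (m.lam + 2 * m.mu) / ((m.lam + 3 * m.mu) * Real.pi)

end Material

/-- The data of the problem: an interface crack `|x| < l` between an upper half-plane (material
`upper`, sign `p`) and a lower half-plane (material `lower`, sign `m`), the surface tension
parameters `γ₀`, `γ₁` on the upper bank (`p`), on the lower bank (`m`) and on the bonded interface
(`i`), the stresses `σ`, `τ` at infinity and the loads on the two banks. -/
structure Problem where
  l : ℝ
  upper : Material
  lower : Material
  gamma0p : ℝ
  gamma0m : ℝ
  gamma0i : ℝ
  gamma1p : ℝ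
  gamma1m : ℝ
  gamma1i : ℝ
  sigma : ℝ
  tau : ℝ
  fp : ℝ → ℝ
  fm : ℝ → ℝ
  gp : ℝ → ℝ
  gm : ℝ → ℝ

/-- The six unknown functions. `phi1`, `phi2` are the values of `u_{1,1}` and `psi1`, `psi2` the
values of `u_{2,1}` on the upper and the lower bank of the crack (used for `|x| < l`); `phi`, `psi`
are the common values of `u_{1,1}`, `u_{2,1}` on the bonded interface (used for `|x| > l`). All of
them belong to the field from which the homogeneous field at infinity has been subtracted. -/
structure Unknowns where
  phi1 : ℝ → ℝ
  phi2 : ℝ → ℝ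
  phi : ℝ → ℝ
  psi1 : ℝ → ℝ
  psi2 : ℝ → ℝ
  psi : ℝ → ℝ

/-- The function equal to `inner` on the crack `|x| < l` and to `outer` elsewhere. -/
def glue (l : ℝ) (inner outer : ℝ → ℝ) (x : ℝ) : ℝ := if |x| < l then inner x else outer x

namespace Problem

variable (P : Problem)

/-- The crack, `|x| < l`. -/
def crack : Set ℝ := {x | |x| < P.l}

/-- The bonded part of the interface, `|x| > l`. -/
def bonded : Set ℝ := {x | P.l < |x|}

/-- The boundary value `u_{1,1}^{0+}` from the upper half-plane on the whole line. -/
def u11p (w : Unknowns) : ℝ → ℝ := glue P.l w.phi1 w.phi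

/-- The boundary value `u_{1,1}^{0-}` from the lower half-plane on the whole line. -/
def u11m (w : Unknowns) : ℝ → ℝ := glue P.l w.phi2 w.phi

/-- The boundary value `u_{2,1}^{0+}` from the upper half-plane on the whole line. -/
def u21p (w : Unknowns) : ℝ → ℝ := glue P.l w.psi1 w.psi

/-- The boundary value `u_{2,1}^{0-}` from the lower half-plane on the whole line. -/
def u21m (w : Unknowns) : ℝ → ℝ := glue P.l w.psi2 w.psi

/-- `σ₁₂^{0+}`, by the Dirichlet-to-Neumann map of the upper half-plane. -/
def sigma12p (w : Unknowns) (x : ℝ) : ℝ :=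
  P.upper.alpha * P.u21p w x + P.upper.beta * cauchyPV (P.u11p w) x

/-- `σ₂₂^{0+}`, by the Dirichlet-to-Neumann map of the upper half-plane. -/
def sigma22p (w : Unknowns) (x : ℝ) : ℝ :=
  -P.upper.alpha * P.u11p w x + P.upper.beta * cauchyPV (P.u21p w) x

/-- `σ₁₂^{0-}`, by the Dirichlet-to-Neumann map of the lower half-plane. -/
def sigma12m (w : Unknowns) (x : ℝ) : ℝ :=
  P.lower.alpha * P.u21m w x - P.lower.beta * cauchyPV (P.u11m w) x

/-- `σ₂₂^{0-}`, by the Dirichlet-to-Neumann map of the lower half-plane. -/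
def sigma22m (w : Unknowns) (x : ℝ) : ℝ :=
  -P.lower.alpha * P.u11m w x - P.lower.beta * cauchyPV (P.u21m w) x

/-- Total stresses: the homogeneous field at infinity is added. -/
def totalSigma12p (w : Unknowns) (x : ℝ) : ℝ := P.sigma12p w x + P.tau

def totalSigma12m (w : Unknowns) (x : ℝ) : ℝ := P.sigma12m w x + P.tau

def totalSigma22p (w : Unknowns) (x : ℝ) : ℝ := P.sigma22p w x + P.sigma

def totalSigma22m (w : Unknowns) (x : ℝ) : ℝ := P.sigma22m w x + P.sigma

/-- Standing assumptions on the data: a crack of positive length, elastic materials with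
`α₁ ≠ α₂`, shear loads continuous and normal loads Hölder continuous up to the tips. -/
structure Admissible : Prop where
  l_pos : 0 < P.l
  upper : P.upper.Admissible
  lower : P.lower.Admissible
  alpha_ne : P.upper.alpha ≠ P.lower.alpha
  fp_cont : ContinuousOn P.fp (Set.Icc (-P.l) P.l)
  fm_cont : ContinuousOn P.fm (Set.Icc (-P.l) P.l)
  gp_holder : ∃ C s : ℝ≥0, 0 < s ∧ HolderOnWith C s P.gp (Set.Icc (-P.l) P.l)
  gm_holder : ∃ C s : ℝ≥0, 0 < s ∧ HolderOnWith C s P.gm (Set.Icc (-P.l) P.l)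

/-- `w` is a solution of the system of six singular integro-differential equations: all principal
values exist off the tips, `ψ₁, ψ₂, ψ` are twice differentiable off the tips, and the jump
momentum balance holds on the two banks and on the bonded interface. -/
structure IsSolution (w : Unknowns) : Prop where
  pv_u11p : ∀ x : ℝ, |x| ≠ P.l → CauchyPVExists (P.u11p w) x
  pv_u11m : ∀ x : ℝ, |x| ≠ P.l → CauchyPVExists (P.u11m w) x
  pv_u21p : ∀ x : ℝ, |x| ≠ P.l → CauchyPVExists (P.u21p w) x
  pv_u21m : ∀ x : ℝ, |x| ≠ P.l → CauchyPVExists (P.u21m w) x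
  diff_psi1 : DifferentiableOn ℝ w.psi1 P.crack ∧ DifferentiableOn ℝ (deriv w.psi1) P.crack
  diff_psi2 : DifferentiableOn ℝ w.psi2 P.crack ∧ DifferentiableOn ℝ (deriv w.psi2) P.crack
  diff_psi : DifferentiableOn ℝ w.psi P.bonded ∧ DifferentiableOn ℝ (deriv w.psi) P.bonded
  shear_upper : ∀ x ∈ P.crack,
    P.sigma12p w x + P.tau = P.gamma1p * deriv (deriv w.psi1) x + P.fp x
  normal_upper : ∀ x ∈ P.crack,
    P.sigma22p w x + P.sigma = -P.gamma0p * deriv w.psi1 x + P.gp x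
  shear_lower : ∀ x ∈ P.crack,
    P.sigma12m w x + P.tau = -P.gamma1m * deriv (deriv w.psi2) x + P.fm x
  normal_lower : ∀ x ∈ P.crack,
    P.sigma22m w x + P.sigma = P.gamma0m * deriv w.psi2 x + P.gm x
  shear_bonded : ∀ x ∈ P.bonded,
    P.sigma12p w x - P.sigma12m w x = P.gamma1i * deriv (deriv w.psi) x
  normal_bonded : ∀ x ∈ P.bonded,
    P.sigma22p w x - P.sigma22m w x = -P.gamma0i * deriv w.psi x

end Problem

/-! ### Behaviour at a tip -/

/-- Along `L` (a filter of punctured one-sided neighbourhoods of `p`), `F` is dominated by an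
integrable power of the distance to `p`. -/
def AtMostIntegrablePower (F : ℝ → ℝ) (p : ℝ) (L : Filter ℝ) : Prop :=
  ∃ s : ℝ, -1 < s ∧ F =O[L] fun x => |x - p| ^ s

/-- `F` has an integrable power singularity at `p`: its leading behaviour is `Re (A r ^ γ)`, not
identically zero, where `r = |x - p|` and the complex exponent `γ ≠ 0` has `-1 < Re γ ≤ 0`. Purely
imaginary exponents (bounded oscillation) and `γ = -1/2 + i ε` are included. -/
def HasPowerSingularity (F : ℝ → ℝ) (p : ℝ) (L : Filter ℝ) : Prop :=
  ∃ γ A : ℂ, -1 < γ.re ∧ γ.re ≤ 0 ∧ γ ≠ 0 ∧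
    (∃ r : ℝ, 0 < r ∧ (A * (r : ℂ) ^ γ).re ≠ 0) ∧
    (fun x => F x - (A * ((|x - p| : ℝ) : ℂ) ^ γ).re) =o[L] fun x => |x - p| ^ γ.re

/-- `F(x) = A ln |x - p| + c + o(1)`. -/
def HasLogExpansion (F : ℝ → ℝ) (p : ℝ) (L : Filter ℝ) : Prop :=
  ∃ A c : ℝ, Tendsto (fun x => F x - A * Real.log |x - p|) L (𝓝 c)

/-- `F(x) = B ln² |x - p| + C ln |x - p| + c + o(1)`. -/
def HasLogSqExpansion (F : ℝ → ℝ) (p : ℝ) (L : Filter ℝ) : Prop :=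
  ∃ B C c : ℝ,
    Tendsto (fun x => F x - (B * Real.log |x - p| ^ 2 + C * Real.log |x - p|)) L (𝓝 c)

/-- `F` is bounded near the limit point of `L`. -/
def BoundedAlong (F : ℝ → ℝ) (L : Filter ℝ) : Prop := F =O[L] fun _ => (1 : ℝ)

/-- At both tips `x = ±l` the unknowns `φ_k` and `ψ_k''` have at most integrable power
singularities. -/
structure Problem.AtMostPowerAtTips (P : Problem) (w : Unknowns) : Prop where
  phi1 : ∀ p : ℝ, |p| = P.l → AtMostIntegrablePower w.phi1 p (𝓝[P.crack] p)
  phi2 : ∀ p : ℝ, |p| = P.l → AtMostIntegrablePower w.phi2 p (𝓝[P.crack] p)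
  phi : ∀ p : ℝ, |p| = P.l → AtMostIntegrablePower w.phi p (𝓝[P.bonded] p)
  psi1 : ∀ p : ℝ, |p| = P.l → AtMostIntegrablePower (deriv (deriv w.psi1)) p (𝓝[P.crack] p)
  psi2 : ∀ p : ℝ, |p| = P.l → AtMostIntegrablePower (deriv (deriv w.psi2)) p (𝓝[P.crack] p)
  psi : ∀ p : ℝ, |p| = P.l → AtMostIntegrablePower (deriv (deriv w.psi)) p (𝓝[P.bonded] p)

/-- None of the unknowns, of the `ψ_k''` and of the stresses (on the banks and on the bonded
interface) has an integrable power singularity at the tip `p`. -/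
structure Problem.NoPowerSingularity (P : Problem) (w : Unknowns) (p : ℝ) : Prop where
  phi1 : ¬ HasPowerSingularity w.phi1 p (𝓝[P.crack] p)
  phi2 : ¬ HasPowerSingularity w.phi2 p (𝓝[P.crack] p)
  phi : ¬ HasPowerSingularity w.phi p (𝓝[P.bonded] p)
  psi1 : ¬ HasPowerSingularity w.psi1 p (𝓝[P.crack] p)
  psi2 : ¬ HasPowerSingularity w.psi2 p (𝓝[P.crack] p)
  psi : ¬ HasPowerSingularity w.psi p (𝓝[P.bonded] p)
  psi1_dd : ¬ HasPowerSingularity (deriv (deriv w.psi1)) p (𝓝[P.crack] p)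
  psi2_dd : ¬ HasPowerSingularity (deriv (deriv w.psi2)) p (𝓝[P.crack] p)
  psi_dd : ¬ HasPowerSingularity (deriv (deriv w.psi)) p (𝓝[P.bonded] p)
  sigma12p_crack : ¬ HasPowerSingularity (P.totalSigma12p w) p (𝓝[P.crack] p)
  sigma12m_crack : ¬ HasPowerSingularity (P.totalSigma12m w) p (𝓝[P.crack] p)
  sigma22p_crack : ¬ HasPowerSingularity (P.totalSigma22p w) p (𝓝[P.crack] p)
  sigma22m_crack : ¬ HasPowerSingularity (P.totalSigma22m w) p (𝓝[P.crack] p)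
  sigma12p_bonded : ¬ HasPowerSingularity (P.totalSigma12p w) p (𝓝[P.bonded] p)
  sigma12m_bonded : ¬ HasPowerSingularity (P.totalSigma12m w) p (𝓝[P.bonded] p)
  sigma22p_bonded : ¬ HasPowerSingularity (P.totalSigma22p w) p (𝓝[P.bonded] p)
  sigma22m_bonded : ¬ HasPowerSingularity (P.totalSigma22m w) p (𝓝[P.bonded] p)

/-- The singularities at the tip `p` are at most logarithmic: `φ_k`, that is `u_{1,1}^±`, is
logarithmic; `ψ_k''` and `σ₁₂^±` are square-logarithmic; `ψ_k`, that is `u_{2,1}^±`, and `ψ_k'`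
are bounded; `σ₂₂^±` is bounded on the banks of the crack; on the bonded interface its jump is
bounded and each of the two values is at most logarithmic. -/
structure Problem.AtMostLogarithmic (P : Problem) (w : Unknowns) (p : ℝ) : Prop where
  phi1 : HasLogExpansion w.phi1 p (𝓝[P.crack] p)
  phi2 : HasLogExpansion w.phi2 p (𝓝[P.crack] p)
  phi : HasLogExpansion w.phi p (𝓝[P.bonded] p)
  psi1_dd : HasLogSqExpansion (deriv (deriv w.psi1)) p (𝓝[P.crack] p)
  psi2_dd : HasLogSqExpansion (deriv (deriv w.psi2)) p (𝓝[P.crack] p)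
  psi_dd : HasLogSqExpansion (deriv (deriv w.psi)) p (𝓝[P.bonded] p)
  psi1 : BoundedAlong w.psi1 (𝓝[P.crack] p)
  psi2 : BoundedAlong w.psi2 (𝓝[P.crack] p)
  psi : BoundedAlong w.psi (𝓝[P.bonded] p)
  psi1_d : BoundedAlong (deriv w.psi1) (𝓝[P.crack] p)
  psi2_d : BoundedAlong (deriv w.psi2) (𝓝[P.crack] p)
  psi_d : BoundedAlong (deriv w.psi) (𝓝[P.bonded] p)
  sigma12p_crack : HasLogSqExpansion (P.totalSigma12p w) p (𝓝[P.crack] p)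
  sigma12m_crack : HasLogSqExpansion (P.totalSigma12m w) p (𝓝[P.crack] p)
  sigma12p_bonded : HasLogSqExpansion (P.totalSigma12p w) p (𝓝[P.bonded] p)
  sigma12m_bonded : HasLogSqExpansion (P.totalSigma12m w) p (𝓝[P.bonded] p)
  sigma22p_crack : BoundedAlong (P.totalSigma22p w) (𝓝[P.crack] p)
  sigma22m_crack : BoundedAlong (P.totalSigma22m w) (𝓝[P.crack] p)
  sigma22_jump_bonded :
    BoundedAlong (fun x => P.totalSigma22p w x - P.totalSigma22m w x) (𝓝[P.bonded] p)
  sigma22p_bonded : HasLogExpansion (P.totalSigma22p w) p (𝓝[P.bonded] p)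
  sigma22m_bonded : HasLogExpansion (P.totalSigma22m w) p (𝓝[P.bonded] p)

end InterfaceCrack

end

/-! The argument is a bootstrap at each tip, run separately along the two rays leaving it: every
function is read as a germ in the distance `t → 0+`. Integrating the bound on `ψ''` shows that `ψ'`
and then `ψ` are Hölder continuous up to the tip on each side (`HolderNearZero.of_deriv_isBigO`). A
density that is Hölder on both sides of a point, with a possible jump there, has a Cauchy principal
value of the form `J log t` plus a Hölder germ (`logHolder_cauchyPV`). The normal balances contain
`φ_k` algebraically, with coefficient `α₁` or `α₂` on the banks and `α₁ - α₂` on the bonded part, so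
they can be solved for `φ_k`: each is `A log t` plus a Hölder germ. The principal value of such a
density is a quadratic polynomial in `log t` up to `o(1)` (`logSq_cauchyPV`). This gives the shear
stresses, and the shear balances, divided by the nonzero `γ₁`, give `ψ''`. The remainder of `φ_k`
has to be Hölder, not merely `o(1)`, because it is put through one more Cauchy transform; this is
why the normal loads are Hölder while continuity is enough for the shear loads, which enter only at
the end. Power singularities are then excluded by comparison (`LogSqNearZero.re_cpow_eq_zero`): a
quadratic in `log t` is negligible against a negative power, and it cannot imitate a nonzero
oscillation in `log t`. -/

noncomputable section

namespace InterfaceCrack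

/-! ### Germs at `0+` of Hölder continuous functions -/

/-- `h` is Hölder continuous on some interval `(0, a]`. -/
def HolderNearZero (h : ℝ → ℝ) : Prop :=
  ∃ a C δ : ℝ, 0 < a ∧ a ≤ 1 ∧ 0 ≤ C ∧ 0 < δ ∧ δ ≤ 1 ∧
    ∀ s ∈ Set.Ioc 0 a, ∀ t ∈ Set.Ioc 0 a, |h s - h t| ≤ C * |s - t| ^ δ

namespace HolderNearZero

variable {h k : ℝ → ℝ}

theorem eventually_Ioc {a : ℝ} (ha : 0 < a) : ∀ᶠ t in 𝓝[>] (0 : ℝ), t ∈ Set.Ioc 0 a :=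
  Ioc_mem_nhdsGT ha

theorem abs_sub_rpow_le {a s t δ η : ℝ} (ha : a ≤ 1) (hs : s ∈ Set.Ioc 0 a)
    (ht : t ∈ Set.Ioc 0 a) (hη : 0 < η) (hle : η ≤ δ) : |s - t| ^ δ ≤ |s - t| ^ η := by
  refine Real.rpow_le_rpow_of_exponent_ge' (abs_nonneg _) ?_ hη.le hle
  rw [abs_le]
  constructor <;> linarith [hs.1, hs.2, ht.1, ht.2]

/-- On an interval of length at most 1, lowering the exponent only weakens a Hölder estimate, so two
germs can share one interval, constant and exponent. The bound `b` allows shrinking into a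
prescribed neighbourhood. -/
theorem pair (hh : HolderNearZero h) (hk : HolderNearZero k) (b : ℝ) (hb : 0 < b) :
    ∃ a C δ : ℝ, 0 < a ∧ a ≤ 1 ∧ a ≤ b ∧ 0 ≤ C ∧ 0 < δ ∧ δ ≤ 1 ∧
      (∀ s ∈ Set.Ioc 0 a, ∀ t ∈ Set.Ioc 0 a, |h s - h t| ≤ C * |s - t| ^ δ) ∧
      ∀ s ∈ Set.Ioc 0 a, ∀ t ∈ Set.Ioc 0 a, |k s - k t| ≤ C * |s - t| ^ δ := by
  obtain ⟨a, C, δ, ha, ha1, hC, hδ, hδ1, H⟩ := hh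
  obtain ⟨a', C', δ', ha', ha1', hC', hδ', hδ1', H'⟩ := hk
  have hm : 0 < min δ δ' := lt_min hδ hδ'
  refine ⟨min (min a a') b, max C C', min δ δ', by positivity,
    (min_le_left _ _).trans ((min_le_left _ _).trans ha1), min_le_right _ _,
    hC.trans (le_max_left _ _), hm, (min_le_left _ _).trans hδ1, ?_, ?_⟩
  · intro s hs t ht
    have hs' : s ∈ Set.Ioc 0 a := ⟨hs.1, hs.2.trans ((min_le_left _ _).trans (min_le_left _ _))⟩
    have ht' : t ∈ Set.Ioc 0 a := ⟨ht.1, ht.2.trans ((min_le_left _ _).trans (min_le_left _ _))⟩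
    exact (H s hs' t ht').trans (mul_le_mul (le_max_left _ _)
      (abs_sub_rpow_le ha1 hs' ht' hm (min_le_left _ _)) (by positivity)
      (hC.trans (le_max_left _ _)))
  · intro s hs t ht
    have hs' : s ∈ Set.Ioc 0 a' := ⟨hs.1, hs.2.trans ((min_le_left _ _).trans (min_le_right _ _))⟩
    have ht' : t ∈ Set.Ioc 0 a' := ⟨ht.1, ht.2.trans ((min_le_left _ _).trans (min_le_right _ _))⟩
    exact (H' s hs' t ht').trans (mul_le_mul (le_max_right _ _)
      (abs_sub_rpow_le ha1' hs' ht' hm (min_le_right _ _)) (by positivity)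
      (hC.trans (le_max_left _ _)))

theorem congr (hh : HolderNearZero h) (he : h =ᶠ[𝓝[>] 0] k) : HolderNearZero k := by
  obtain ⟨b, hb, hbk⟩ := mem_nhdsGT_iff_exists_Ioc_subset.1 he
  obtain ⟨a, C, δ, ha, ha1, hab, hC, hδ, hδ1, H, -⟩ := hh.pair hh b hb
  refine ⟨a, C, δ, ha, ha1, hC, hδ, hδ1, fun s hs t ht => ?_⟩
  have h1 : h s = k s := hbk ⟨hs.1, hs.2.trans hab⟩
  have h2 : h t = k t := hbk ⟨ht.1, ht.2.trans hab⟩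
  rw [← h1, ← h2]
  exact H s hs t ht

theorem add (hh : HolderNearZero h) (hk : HolderNearZero k) :
    HolderNearZero (fun t => h t + k t) := by
  obtain ⟨a, C, δ, ha, ha1, -, hC, hδ, hδ1, H, H'⟩ := hh.pair hk 1 one_pos
  refine ⟨a, C + C, δ, ha, ha1, by positivity, hδ, hδ1, fun s hs t ht => ?_⟩
  calc |h s + k s - (h t + k t)| = |(h s - h t) + (k s - k t)| := by ring_nf
    _ ≤ |h s - h t| + |k s - k t| := abs_add_le _ _
    _ ≤ (C + C) * |s - t| ^ δ := by linarith [H s hs t ht, H' s hs t ht]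

theorem bounded {a C δ : ℝ} (ha : 0 < a) (ha1 : a ≤ 1) (hC : 0 ≤ C) (hδ : 0 < δ)
    (H : ∀ s ∈ Set.Ioc 0 a, ∀ t ∈ Set.Ioc 0 a, |h s - h t| ≤ C * |s - t| ^ δ) :
    ∀ s ∈ Set.Ioc 0 a, |h s| ≤ |h a| + C := by
  intro s hs
  have h1 := H s hs a ⟨ha, le_rfl⟩
  have h2 : |s - a| ^ δ ≤ 1 := by
    refine Real.rpow_le_one (abs_nonneg _) ?_ hδ.le
    rw [abs_le]
    constructor <;> linarith [hs.1, hs.2]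
  have h3 : |h s| ≤ |h s - h a| + |h a| := by
    simpa using abs_add_le (h s - h a) (h a)
  have h4 := mul_le_mul_of_nonneg_left h2 hC
  linarith

theorem mul (hh : HolderNearZero h) (hk : HolderNearZero k) :
    HolderNearZero (fun t => h t * k t) := by
  obtain ⟨a, C, δ, ha, ha1, -, hC, hδ, hδ1, H, H'⟩ := hh.pair hk 1 one_pos
  have hb := bounded ha ha1 hC hδ H
  have hb' := bounded ha ha1 hC hδ H'
  refine ⟨a, (|h a| + C) * C + (|k a| + C) * C, δ, ha, ha1, by positivity, hδ, hδ1,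
    fun s hs t ht => ?_⟩
  calc |h s * k s - h t * k t| = |h s * (k s - k t) + k t * (h s - h t)| := by ring_nf
    _ ≤ |h s| * |k s - k t| + |k t| * |h s - h t| := by
        rw [← abs_mul, ← abs_mul]; exact abs_add_le _ _
    _ ≤ (|h a| + C) * (C * |s - t| ^ δ) + (|k a| + C) * (C * |s - t| ^ δ) := by
        gcongr
        · exact hb s hs
        · exact H' s hs t ht
        · exact hb' t ht
        · exact H s hs t ht
    _ = _ := by ring

theorem const (c : ℝ) : HolderNearZero (fun _ => c) :=
  ⟨1, 0, 1, one_pos, le_rfl, le_rfl, one_pos, le_rfl, by simp⟩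

theorem const_mul (c : ℝ) (hh : HolderNearZero h) : HolderNearZero (fun t => c * h t) :=
  (const c).mul hh

theorem neg (hh : HolderNearZero h) : HolderNearZero (fun t => -h t) :=
  (hh.const_mul (-1)).congr (Eventually.of_forall fun t => by ring)

theorem sub (hh : HolderNearZero h) (hk : HolderNearZero k) :
    HolderNearZero (fun t => h t - k t) :=
  (hh.add hk.neg).congr (Eventually.of_forall fun t => by ring)

/-- A Hölder germ has a limit, attained at a Hölder rate. -/
theorem exists_limit {a C δ : ℝ} (ha : 0 < a) (hC : 0 ≤ C) (hδ : 0 < δ)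
    (H : ∀ s ∈ Set.Ioc 0 a, ∀ t ∈ Set.Ioc 0 a, |h s - h t| ≤ C * |s - t| ^ δ) :
    ∃ c : ℝ, ∀ s ∈ Set.Ioc 0 a, |h s - c| ≤ C * s ^ δ := by
  have hlim : Tendsto (fun n : ℕ => a / ((n : ℝ) + 1)) atTop (𝓝 0) := by
    simpa [div_eq_mul_inv] using tendsto_one_div_add_atTop_nhds_zero_nat.const_mul a
  have hmem : ∀ n : ℕ, a / ((n : ℝ) + 1) ∈ Set.Ioc 0 a := fun n =>
    ⟨by positivity, div_le_self ha.le (by linarith [n.cast_nonneg (α := ℝ)])⟩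
  -- Two sample points with indices at least `N` lie within `a / (N + 1)` of each other, so the
  -- Hölder estimate itself is the Cauchy criterion. Letting the second point tend to 0 in the same
  -- estimate then gives the rate.
  have hcau : CauchySeq (fun n : ℕ => h (a / ((n : ℝ) + 1))) := by
    refine cauchySeq_of_le_tendsto_0 (fun n : ℕ => C * (a / ((n : ℝ) + 1)) ^ δ) ?_ ?_
    · intro n m N hn hm
      rw [Real.dist_eq]
      refine (H _ (hmem n) _ (hmem m)).trans (mul_le_mul_of_nonneg_left ?_ hC)
      refine Real.rpow_le_rpow (abs_nonneg _) ?_ hδ.le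
      have h1 : a / ((n : ℝ) + 1) ≤ a / ((N : ℝ) + 1) := by gcongr
      have h2 : a / ((m : ℝ) + 1) ≤ a / ((N : ℝ) + 1) := by gcongr
      rw [abs_le]
      constructor <;> linarith [(hmem n).1, (hmem m).1]
    · have := (hlim.rpow_const (Or.inr hδ.le)).const_mul C
      simpa [Real.zero_rpow hδ.ne'] using this
  obtain ⟨c, hc⟩ := cauchySeq_tendsto_of_complete hcau
  refine ⟨c, fun s hs => ?_⟩
  have h1 : Tendsto (fun n : ℕ => |h s - h (a / ((n : ℝ) + 1))|) atTop (𝓝 |h s - c|) :=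
    (tendsto_const_nhds.sub hc).abs
  have h2 : Tendsto (fun n : ℕ => C * |s - a / ((n : ℝ) + 1)| ^ δ) atTop (𝓝 (C * s ^ δ)) := by
    have := (((tendsto_const_nhds (x := s)).sub hlim).abs.rpow_const (p := δ)
      (Or.inr hδ.le)).const_mul C
    simpa [abs_of_pos hs.1] using this
  exact le_of_tendsto_of_tendsto' h1 h2 fun n => H s hs _ (hmem n)

theorem exists_tendsto (hh : HolderNearZero h) : ∃ c : ℝ, Tendsto h (𝓝[>] 0) (𝓝 c) := by
  obtain ⟨a, C, δ, ha, -, hC, hδ, -, H⟩ := hh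
  obtain ⟨c, hc⟩ := exists_limit ha hC hδ H
  refine ⟨c, tendsto_iff_norm_sub_tendsto_zero.2 ?_⟩
  have h1 : Tendsto (fun s : ℝ => C * s ^ δ) (𝓝[>] 0) (𝓝 0) := by
    have : Tendsto (fun s : ℝ => s) (𝓝[>] 0) (𝓝 0) := nhdsWithin_le_nhds
    simpa [Real.zero_rpow hδ.ne'] using (this.rpow_const (Or.inr hδ.le)).const_mul C
  refine squeeze_zero' (Eventually.of_forall fun _ => norm_nonneg _) ?_ h1
  filter_upwards [eventually_Ioc ha] with s hs using hc s hs

theorem of_lipschitz {a C : ℝ} (ha : 0 < a) (hC : 0 ≤ C)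
    (H : ∀ s ∈ Set.Ioc 0 a, ∀ t ∈ Set.Ioc 0 a, |h s - h t| ≤ C * |s - t|) :
    HolderNearZero h := by
  refine ⟨min a 1, C, 1, by positivity, min_le_right _ _, hC, one_pos, le_rfl,
    fun s hs t ht => ?_⟩
  rw [Real.rpow_one]
  exact H s ⟨hs.1, hs.2.trans (min_le_left _ _)⟩ t ⟨ht.1, ht.2.trans (min_le_left _ _)⟩

/-- A function whose derivative is dominated by an integrable power of `t` is a Hölder germ. -/
theorem of_deriv_isBigO {s : ℝ} (hs : -1 < s) (hd : ∀ᶠ t in 𝓝[>] (0 : ℝ), DifferentiableAt ℝ h t)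
    (hO : deriv h =O[𝓝[>] 0] fun t : ℝ => t ^ s) : HolderNearZero h := by
  -- Lowering the exponent into `(-1, 0)` puts `q + 1` in `(0, 1)`, as needed both for an admissible
  -- Hölder exponent and for subadditivity of `t ^ (q + 1)`.
  set q : ℝ := min s (-1 / 2) with hq
  have hq1 : -1 < q := lt_min hs (by norm_num)
  have hq0 : q < 0 := (min_le_right _ _).trans_lt (by norm_num)
  obtain ⟨C, hC, hCO⟩ := hO.exists_pos
  obtain ⟨b, hb, hbk⟩ := mem_nhdsGT_iff_exists_Ioc_subset.1 (hd.and hCO.bound)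
  set a := min b 1
  have ha : 0 < a := lt_min hb one_pos
  have ha1 : a ≤ 1 := min_le_right _ _
  have key : ∀ t ∈ Set.Ioc 0 a, DifferentiableAt ℝ h t ∧ |deriv h t| ≤ C * t ^ q := by
    intro t ht
    obtain ⟨h1, h2⟩ := hbk ⟨ht.1, ht.2.trans (min_le_left _ _)⟩
    refine ⟨h1, ?_⟩
    rw [Real.norm_eq_abs, Real.norm_eq_abs, abs_of_pos (Real.rpow_pos_of_pos ht.1 s)] at h2
    exact h2.trans (mul_le_mul_of_nonneg_left
      (Real.rpow_le_rpow_of_exponent_ge ht.1 (ht.2.trans ha1) (min_le_left _ _)) hC.le)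
  have main : ∀ x ∈ Set.Ioc 0 a, ∀ y ∈ Set.Ioc 0 a, x ≤ y →
      |h y - h x| ≤ C / (q + 1) * (y - x) ^ (q + 1) := by
    intro x hx y hy hxy
    have hsub : ∀ t ∈ Set.Icc x y, t ∈ Set.Ioc 0 a := fun t ht =>
      ⟨hx.1.trans_le ht.1, ht.2.trans hy.2⟩
    have hB : ∀ t ∈ Set.Icc x y, HasDerivAt
        (fun t : ℝ => C / (q + 1) * (t ^ (q + 1) - x ^ (q + 1))) (C * t ^ q) t := by
      intro t ht
      have h1 := ((Real.hasDerivAt_rpow_const (p := q + 1)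
        (Or.inl (hsub t ht).1.ne')).sub_const (x ^ (q + 1))).const_mul (C / (q + 1))
      refine h1.congr_deriv ?_
      have : q + 1 ≠ 0 := by linarith
      rw [add_sub_cancel_right]
      field_simp
    -- Comparison with the explicit primitive of `C t ^ q` needs only the pointwise bound on the
    -- derivative, so neither continuity nor integrability of `deriv h` enters.
    have h2 := image_norm_le_of_norm_deriv_right_le_deriv_boundary' (a := x) (b := y)
      (f := fun t => h t - h x) (f' := deriv h)
      (B := fun t : ℝ => C / (q + 1) * (t ^ (q + 1) - x ^ (q + 1))) (B' := fun t => C * t ^ q)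
      (fun t ht => ((key t (hsub t ht)).1.sub_const _).continuousAt.continuousWithinAt)
      (fun t ht => (((key t (hsub t ⟨ht.1, ht.2.le⟩)).1.hasDerivAt).sub_const _).hasDerivWithinAt)
      (by simp)
      (fun t ht => (hB t ht).continuousAt.continuousWithinAt)
      (fun t ht => (hB t ⟨ht.1, ht.2.le⟩).hasDerivWithinAt)
      (fun t ht => (key t (hsub t ⟨ht.1, ht.2.le⟩)).2)
      (Set.right_mem_Icc.2 hxy)
    refine (show |h y - h x| ≤ _ from h2).trans (mul_le_mul_of_nonneg_left ?_ ?_)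
    · have h3 := Real.rpow_add_le_add_rpow hx.1.le (sub_nonneg.2 hxy) (p := q + 1)
        (by linarith) (by linarith)
      rw [add_sub_cancel] at h3
      linarith
    · exact div_nonneg hC.le (by linarith)
  refine ⟨a, C / (q + 1), q + 1, ha, ha1, div_nonneg hC.le (by linarith), by linarith, by linarith,
    fun x hx y hy => ?_⟩
  rcases le_total x y with hxy | hxy
  · rw [abs_sub_comm, abs_sub_comm x y, abs_of_nonneg (sub_nonneg.2 hxy)]
    exact main x hx y hy hxy
  · rw [abs_of_nonneg (sub_nonneg.2 hxy)]
    exact main y hy x hx hxy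

end HolderNearZero

/-! ### Hölder continuity of the finite Cauchy transform -/

theorem intervalIntegrable_abs_sub_rpow {q : ℝ} (hq : -1 < q) (x b c : ℝ) :
    IntervalIntegrable (fun r : ℝ => |r - x| ^ q) volume b c := by
  have h0 : ∀ d : ℝ, 0 ≤ d → IntervalIntegrable (fun r : ℝ => |r| ^ q) volume 0 d := by
    intro d hd
    refine (intervalIntegral.intervalIntegrable_rpow' hq).congr fun r hr => ?_
    rw [Set.uIoc_of_le hd] at hr
    simp only [abs_of_pos hr.1]
  have h1 : ∀ d : ℝ, IntervalIntegrable (fun r : ℝ => |r| ^ q) volume 0 d := by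
    intro d
    rcases le_total 0 d with hd | hd
    · exact h0 d hd
    · have := (IntervalIntegrable.iff_comp_neg (f := fun r : ℝ => |r| ^ q) (a := 0)
        (b := -d)).1 (h0 (-d) (by linarith))
      simpa using this
  have h2 := ((h1 (b - x)).symm.trans (h1 (c - x))).comp_sub_right x
  simpa using h2

/-- After translation the interval stays inside `[-2a, 2a]`, which makes the bound uniform in the
singular point `x`. -/
theorem integral_abs_sub_rpow_le {q a x : ℝ} (hq : -1 < q) (hx : x ∈ Set.Icc (-a) a) :
    ∫ r in (-a)..a, |r - x| ^ q ≤ ∫ r in (-(2 * a))..(2 * a), |r| ^ q := by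
  have ha : -a ≤ a := hx.1.trans hx.2
  have h0 : ∀ b c : ℝ, IntervalIntegrable (fun r : ℝ => |r| ^ q) volume b c := fun b c => by
    simpa using intervalIntegrable_abs_sub_rpow hq 0 b c
  rw [intervalIntegral.integral_comp_sub_right (fun r : ℝ => |r| ^ q) x]
  refine intervalIntegral.integral_mono_interval (by linarith [hx.2]) (by linarith)
    (by linarith [hx.1]) (Eventually.of_forall fun r => by positivity) (h0 _ _)

variable {v : ℝ → ℝ} {a C δ : ℝ}

theorem continuousOn_of_holder (hδ : 0 < δ)
    (H : ∀ s ∈ Set.Icc (-a) a, ∀ t ∈ Set.Icc (-a) a, |v s - v t| ≤ C * |s - t| ^ δ) :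
    ContinuousOn v (Set.Icc (-a) a) := by
  intro t ht
  refine tendsto_iff_norm_sub_tendsto_zero.2 ?_
  have h1 : Tendsto (fun s : ℝ => C * |s - t| ^ δ) (𝓝[Set.Icc (-a) a] t) (𝓝 0) := by
    have h2 : Tendsto (fun s : ℝ => |s - t|) (𝓝[Set.Icc (-a) a] t) (𝓝 0) := by
      have : Continuous fun s : ℝ => |s - t| := by fun_prop
      simpa using (this.tendsto t).mono_left nhdsWithin_le_nhds
    simpa [Real.zero_rpow hδ.ne'] using (h2.rpow_const (Or.inr hδ.le)).const_mul C
  refine squeeze_zero' (Eventually.of_forall fun _ => norm_nonneg _) ?_ h1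
  filter_upwards [self_mem_nhdsWithin] with s hs using H s hs t ht

theorem intervalIntegrable_kernel (ha : 0 < a) (hδ : 0 < δ)
    (H : ∀ s ∈ Set.Icc (-a) a, ∀ t ∈ Set.Icc (-a) a, |v s - v t| ≤ C * |s - t| ^ δ)
    {x : ℝ} (hx : x ∈ Set.Icc (-a) a) :
    IntervalIntegrable (fun r => (v r - v x) / (r - x)) volume (-a) a := by
  have hle : -a ≤ a := by linarith
  have hq : -1 < δ - 1 := by linarith
  refine ((intervalIntegrable_abs_sub_rpow hq x (-a) a).const_mul C).mono_fun' ?_ ?_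
  · rw [Set.uIoc_of_le hle]
    have h1 : AEStronglyMeasurable v (volume.restrict (Set.Ioc (-a) a)) :=
      ((continuousOn_of_holder hδ H).aestronglyMeasurable measurableSet_Icc).mono_set
        Set.Ioc_subset_Icc_self
    have h2 : AEStronglyMeasurable (fun r : ℝ => r - x) (volume.restrict (Set.Ioc (-a) a)) := by
      fun_prop
    exact ((h1.sub aestronglyMeasurable_const).aemeasurable.div
      h2.aemeasurable).aestronglyMeasurable
  · rw [Set.uIoc_of_le hle]
    filter_upwards [ae_restrict_mem measurableSet_Ioc,
      ae_restrict_of_ae (Measure.ae_ne volume x)] with r hr hne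
    have hpos : 0 < |r - x| := abs_pos.2 (sub_ne_zero.2 hne)
    rw [Real.norm_eq_abs, abs_div, div_le_iff₀ hpos, Real.rpow_sub_one hpos.ne', mul_assoc,
      div_mul_cancel₀ _ hpos.ne']
    exact H r ⟨hr.1.le, hr.2⟩ x hx

/-- The Hölder exponent is split into two halves: one pays for the factor `|x - y| ^ q`, the other
keeps the remaining singularities `|r - x| ^ (q - 1)` and `|r - y| ^ (q - 1)` integrable. The loss
of half the exponent is harmless, since only some positive exponent is ever needed. -/
theorem abs_kernel_sub_le {q : ℝ} (hC : 0 ≤ C) (hq : 0 < q) (hq1 : q ≤ 1)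
    (H : ∀ s ∈ Set.Icc (-a) a, ∀ t ∈ Set.Icc (-a) a, |v s - v t| ≤ C * |s - t| ^ (2 * q))
    {x y r : ℝ} (hx : x ∈ Set.Icc (-a) a) (hy : y ∈ Set.Icc (-a) a) (hr : r ∈ Set.Icc (-a) a)
    (hxy : x ≠ y) (hrx : r ≠ x) (hry : r ≠ y) :
    |(v r - v x) / (r - x) - (v r - v y) / (r - y)| ≤
      2 * C * |x - y| ^ q * (|r - x| ^ (q - 1) + |r - y| ^ (q - 1)) := by
  have hX : 0 < |r - x| := abs_pos.2 (sub_ne_zero.2 hrx)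
  have hY : 0 < |r - y| := abs_pos.2 (sub_ne_zero.2 hry)
  have hd : 0 < |x - y| := abs_pos.2 (sub_ne_zero.2 hxy)
  have hsplit : ∀ z : ℝ, 0 < z → z ^ (2 * q) = z ^ q * z ^ q := fun z hz => by
    rw [← Real.rpow_add hz]; ring_nf
  have h1 := H r hr x hx
  have h2 := H r hr y hy
  have h3 := H y hy x hx
  rw [abs_sub_comm y x, hsplit _ hd] at h3
  rw [hsplit _ hX] at h1
  rw [hsplit _ hY] at h2
  rw [Real.rpow_sub_one hX.ne', Real.rpow_sub_one hY.ne']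
  have hXY : |r - x| ≤ |r - y| + |x - y| := by
    rw [abs_sub_comm x y]; simpa using abs_add_le (r - y) (y - x)
  have hYX : |r - y| ≤ |r - x| + |x - y| := by
    simpa using abs_add_le (r - x) (x - y)
  have hXq := Real.rpow_pos_of_pos hX q
  have hYq := Real.rpow_pos_of_pos hY q
  have hdq := Real.rpow_pos_of_pos hd q
  -- If `r` is within `|x - y|` of one of the two points, it is within `2|x - y|` of both, and the
  -- two quotients can be estimated separately.
  by_cases hcase : |r - x| ≤ |x - y| ∨ |r - y| ≤ |x - y|
  · have htwo : (2 * |x - y|) ^ q ≤ 2 * |x - y| ^ q := by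
      rw [Real.mul_rpow two_pos.le hd.le]
      gcongr
      simpa using Real.rpow_le_rpow_of_exponent_le one_le_two hq1
    have hX2 : |r - x| ^ q ≤ 2 * |x - y| ^ q := by
      refine (Real.rpow_le_rpow hX.le ?_ hq.le).trans htwo
      rcases hcase with h | h <;> linarith
    have hY2 : |r - y| ^ q ≤ 2 * |x - y| ^ q := by
      refine (Real.rpow_le_rpow hY.le ?_ hq.le).trans htwo
      rcases hcase with h | h <;> linarith
    calc |(v r - v x) / (r - x) - (v r - v y) / (r - y)|
        ≤ |(v r - v x) / (r - x)| + |(v r - v y) / (r - y)| := abs_sub _ _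
      _ ≤ C * (|r - x| ^ q * (2 * |x - y| ^ q)) / |r - x|
          + C * (|r - y| ^ q * (2 * |x - y| ^ q)) / |r - y| := by
        rw [abs_div, abs_div]
        gcongr
        · exact h1.trans (by gcongr)
        · exact h2.trans (by gcongr)
      _ = _ := by ring
  · push Not at hcase
    obtain ⟨hdX, hdY⟩ := hcase
    -- Away from both points the cancellation between the quotients is used. There `|r - y| ≥ |r -
    -- x| / 2`, and `|x - y| / |r - x| ≤ 1` may be raised to the power `q ≤ 1`.
    have e1 : (v r - v x) / (r - x) - (v r - v y) / (r - y) =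
        (v r - v x) * ((x - y) / ((r - x) * (r - y))) + (v y - v x) / (r - y) := by
      have := sub_ne_zero.2 hrx
      have := sub_ne_zero.2 hry
      field_simp
      ring
    have hdX' : |x - y| * |r - x| ^ q ≤ |x - y| ^ q * |r - x| := by
      have h4 : (|x - y| / |r - x|) ^ (1 : ℝ) ≤ (|x - y| / |r - x|) ^ q :=
        Real.rpow_le_rpow_of_exponent_ge (by positivity) ((div_le_one hX).2 hdX.le) hq1
      rw [Real.rpow_one, Real.div_rpow hd.le hX.le, div_le_div_iff₀ hX hXq] at h4
      exact h4
    have hdY' : |x - y| ^ q ≤ |r - y| ^ q := Real.rpow_le_rpow hd.le hdY.le hq.le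
    have hA : |v r - v x| * (|x - y| / (|r - x| * |r - y|)) ≤
        2 * C * |x - y| ^ q * (|r - x| ^ q / |r - x|) := by
      calc |v r - v x| * (|x - y| / (|r - x| * |r - y|))
          ≤ (C * (|r - x| ^ q * |r - x| ^ q)) * (|x - y| / (|r - x| * (|r - x| / 2))) := by
            gcongr
            linarith
        _ = 2 * C * (|r - x| ^ q / |r - x|) * (|x - y| * |r - x| ^ q) / |r - x| := by
            field_simp
        _ ≤ 2 * C * (|r - x| ^ q / |r - x|) * (|x - y| ^ q * |r - x|) / |r - x| := by gcongr
        _ = _ := by field_simp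
    have hB : |v y - v x| / |r - y| ≤ C * |x - y| ^ q * (|r - y| ^ q / |r - y|) := by
      calc |v y - v x| / |r - y| ≤ C * (|x - y| ^ q * |r - y| ^ q) / |r - y| := by
            gcongr
            exact h3.trans (by gcongr)
        _ = _ := by ring
    have hB' : C * |x - y| ^ q * (|r - y| ^ q / |r - y|) ≤
        2 * C * |x - y| ^ q * (|r - y| ^ q / |r - y|) := by
      have : 0 ≤ C * |x - y| ^ q * (|r - y| ^ q / |r - y|) := by positivity
      linarith
    rw [e1]
    refine (abs_add_le _ _).trans ?_
    rw [abs_mul, abs_div, abs_div, abs_mul]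
    linarith

/-- The regularised Cauchy transform of a Hölder continuous function is Hölder continuous. -/
theorem holder_cauchyTransform (ha : 0 < a) (hC : 0 ≤ C) (hδ : 0 < δ) (hδ1 : δ ≤ 1)
    (H : ∀ s ∈ Set.Icc (-a) a, ∀ t ∈ Set.Icc (-a) a, |v s - v t| ≤ C * |s - t| ^ δ) :
    ∃ K : ℝ, 0 ≤ K ∧ ∀ x ∈ Set.Icc (-a) a, ∀ y ∈ Set.Icc (-a) a,
      |(∫ r in (-a)..a, (v r - v x) / (r - x)) - ∫ r in (-a)..a, (v r - v y) / (r - y)| ≤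
        K * |x - y| ^ (δ / 2) := by
  set q := δ / 2 with hqdef
  have hq : 0 < q := by positivity
  have hle : -a ≤ a := by linarith
  set M : ℝ := ∫ r in (-(2 * a))..(2 * a), |r| ^ (q - 1) with hM
  have hM0 : 0 ≤ M := intervalIntegral.integral_nonneg (by linarith) fun r _ => by positivity
  refine ⟨2 * C * (M + M), by positivity, fun x hx y hy => ?_⟩
  rcases eq_or_ne x y with rfl | hxy
  · simp only [sub_self, abs_zero]; positivity
  have hδq : δ = 2 * q := by rw [hqdef]; ring
  have i1 := intervalIntegrable_abs_sub_rpow (q := q - 1) (by linarith) x (-a) a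
  have i2 := intervalIntegrable_abs_sub_rpow (q := q - 1) (by linarith) y (-a) a
  rw [← intervalIntegral.integral_sub (intervalIntegrable_kernel ha hδ H hx)
    (intervalIntegrable_kernel ha hδ H hy), ← Real.norm_eq_abs]
  calc ‖∫ r in (-a)..a, ((v r - v x) / (r - x) - (v r - v y) / (r - y))‖
      ≤ ∫ r in (-a)..a, 2 * C * |x - y| ^ q * (|r - x| ^ (q - 1) + |r - y| ^ (q - 1)) := by
        refine intervalIntegral.norm_integral_le_of_norm_le hle ?_ ((i1.add i2).const_mul _)
        filter_upwards [Measure.ae_ne volume x, Measure.ae_ne volume y] with r h1 h2 hr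
        rw [hδq] at H
        exact abs_kernel_sub_le hC hq (by linarith) H hx hy ⟨hr.1.le, hr.2⟩ hxy h1 h2
    _ = 2 * C * |x - y| ^ q * ((∫ r in (-a)..a, |r - x| ^ (q - 1)) +
          ∫ r in (-a)..a, |r - y| ^ (q - 1)) := by
        rw [intervalIntegral.integral_const_mul, intervalIntegral.integral_add i1 i2]
    _ ≤ 2 * C * |x - y| ^ q * (M + M) := by
        gcongr
        · exact integral_abs_sub_rpow_le (by linarith) hx
        · exact integral_abs_sub_rpow_le (by linarith) hy
    _ = _ := by ring

/-! ### Evaluation of principal values -/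

theorem integral_inv_sub {x b c : ℝ} (h : 0 ∉ Set.uIcc (b - x) (c - x)) :
    ∫ r in b..c, (r - x)⁻¹ = Real.log (c - x) - Real.log (b - x) := by
  rw [intervalIntegral.integral_comp_sub_right (fun r : ℝ => r⁻¹) x, integral_inv h,
    Real.log_div]
  · rintro h0; exact h (h0 ▸ Set.right_mem_uIcc)
  · rintro h0; exact h (h0 ▸ Set.left_mem_uIcc)

/-- Subtracting the value at `x` makes the near part absolutely convergent; the principal value of
the subtracted constant on `[-a, a]` is an explicit logarithm, and the far part does not see the
truncation. -/
theorem tendsto_truncatedCauchy {u : ℝ → ℝ} {x a : ℝ} (h1 : -a < x) (h2 : x < a)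
    (hint : ∀ ε : ℝ, 0 < ε → IntegrableOn (fun r => u r / (r - x)) {r : ℝ | ε < |r - x|})
    (hk : IntervalIntegrable (fun r => (u r - u x) / (r - x)) volume (-a) a) :
    Tendsto (truncatedCauchy u x) (𝓝[>] 0)
      (𝓝 ((∫ r in (-a)..a, (u r - u x) / (r - x)) + u x * (Real.log (a - x) - Real.log (a + x)) +
        ∫ r in (Set.Icc (-a) a)ᶜ, u r / (r - x))) := by
  set k : ℝ → ℝ := fun r => (u r - u x) / (r - x) with hkdef
  set I : ℝ → ℝ := fun y => ∫ r in (-a)..y, k r with hI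
  have hle : -a ≤ a := by linarith
  -- Continuity of the primitive says that the excised piece `(x - ε, x + ε)` contributes nothing in
  -- the limit.
  have hcont : ContinuousAt I x := by
    have h3 := intervalIntegral.continuousOn_primitive_interval (a := -a) (b := a) (f := k)
      (μ := volume)
      (by rw [Set.uIcc_of_le hle, integrableOn_Icc_iff_integrableOn_Ioc,
            ← intervalIntegrable_iff_integrableOn_Ioc_of_le hle]; exact hk)
    rw [Set.uIcc_of_le hle] at h3
    exact h3.continuousAt (Icc_mem_nhds h1 h2)
  have hlim : Tendsto (fun ε => I (x - ε) + (I a - I (x + ε)) +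
      u x * (Real.log (a - x) - Real.log (a + x)) + ∫ r in (Set.Icc (-a) a)ᶜ, u r / (r - x))
      (𝓝[>] 0) (𝓝 (I x + (I a - I x) + u x * (Real.log (a - x) - Real.log (a + x)) +
        ∫ r in (Set.Icc (-a) a)ᶜ, u r / (r - x))) := by
    have hm : Tendsto (fun ε : ℝ => x - ε) (𝓝[>] 0) (𝓝 x) := by
      have : Continuous fun ε : ℝ => x - ε := by fun_prop
      simpa using (this.tendsto 0).mono_left nhdsWithin_le_nhds
    have hp : Tendsto (fun ε : ℝ => x + ε) (𝓝[>] 0) (𝓝 x) := by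
      have : Continuous fun ε : ℝ => x + ε := by fun_prop
      simpa using (this.tendsto 0).mono_left nhdsWithin_le_nhds
    exact (((hcont.tendsto.comp hm).add (tendsto_const_nhds.sub
      (hcont.tendsto.comp hp))).add_const _).add_const _
  rw [show I x + (I a - I x) = I a by ring] at hlim
  refine hlim.congr' ?_
  have hmin : 0 < min (a - x) (a + x) := lt_min (by linarith) (by linarith)
  filter_upwards [Ioo_mem_nhdsGT hmin] with ε hε
  have hε1 : ε < a - x := hε.2.trans_le (min_le_left _ _)
  have hε2 : ε < a + x := hε.2.trans_le (min_le_right _ _)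
  have hset : {r : ℝ | ε < |r - x|} =
      (Set.Icc (-a) a)ᶜ ∪ (Set.Ico (-a) (x - ε) ∪ Set.Ioc (x + ε) a) := by
    ext r
    simp only [Set.mem_ofPred_eq, Set.mem_union, Set.mem_compl_iff, Set.mem_Icc, Set.mem_Ico,
      Set.mem_Ioc, lt_abs, not_and_or, not_le]
    have := hε.1
    constructor
    · rintro (h | h)
      · by_cases hr : r ≤ a
        · exact Or.inr (Or.inr ⟨by linarith, hr⟩)
        · exact Or.inl (Or.inr (not_le.1 hr))
      · by_cases hr : -a ≤ r
        · exact Or.inr (Or.inl ⟨hr, by linarith⟩)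
        · exact Or.inl (Or.inl (not_le.1 hr))
    · rintro ((h | h) | h | h)
      · exact Or.inr (by linarith)
      · exact Or.inl (by linarith)
      · exact Or.inr (by linarith [h.2])
      · exact Or.inl (by linarith [h.1])
  have hI0 := hint ε hε.1
  rw [hset] at hI0
  have hd1 : Disjoint (Set.Icc (-a) a)ᶜ (Set.Ico (-a) (x - ε) ∪ Set.Ioc (x + ε) a) := by
    rw [Set.disjoint_left]
    rintro r hr (h | h)
    · exact hr ⟨h.1, by linarith [h.2, hε.1]⟩
    · exact hr ⟨by linarith [h.1, hε.1], h.2⟩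
  have hd2 : Disjoint (Set.Ico (-a) (x - ε)) (Set.Ioc (x + ε) a) := by
    rw [Set.disjoint_left]
    intro r h h'
    linarith [h.2, h'.1, hε.1]
  have hsub : ∀ b c : ℝ, -a ≤ b → b ≤ c → c ≤ a → IntervalIntegrable k volume b c :=
    fun b c hb hbc hc => hk.mono_set (by
      rw [Set.uIcc_of_le hbc, Set.uIcc_of_le hle]; exact Set.Icc_subset_Icc hb hc)
  have hseg : ∀ b c : ℝ, -a ≤ b → b ≤ c → c ≤ a → 0 ∉ Set.uIcc (b - x) (c - x) →
      ∫ r in b..c, u r / (r - x) = (∫ r in b..c, k r) +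
        u x * (Real.log (c - x) - Real.log (b - x)) := by
    intro b c hb hbc hc h0
    have hi : IntervalIntegrable (fun r : ℝ => (r - x)⁻¹) volume b c := by
      refine ContinuousOn.intervalIntegrable (ContinuousOn.inv₀ (by fun_prop) fun r hr hr0 => ?_)
      rw [Set.uIcc_of_le hbc] at hr
      rw [Set.uIcc_of_le (by linarith)] at h0
      exact h0 ⟨by linarith [hr.1], by linarith [hr.2]⟩
    rw [← integral_inv_sub h0, ← intervalIntegral.integral_const_mul,
      ← intervalIntegral.integral_add (hsub b c hb hbc hc) (hi.const_mul _)]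
    refine intervalIntegral.integral_congr fun r _ => ?_
    simp only [hkdef, div_eq_mul_inv]
    ring
  rw [truncatedCauchy, hset, setIntegral_union hd1 (by measurability) (hI0.mono_set
    Set.subset_union_left) (hI0.mono_set Set.subset_union_right), setIntegral_union hd2
    (by measurability) (hI0.mono_set (Set.subset_union_of_subset_right Set.subset_union_left _))
    (hI0.mono_set (Set.subset_union_of_subset_right Set.subset_union_right _)),
    integral_Ico_eq_integral_Ioc,
    ← intervalIntegral.integral_of_le (by linarith), ← intervalIntegral.integral_of_le (by linarith),
    hseg (-a) (x - ε) le_rfl (by linarith) (by linarith [hε.1]) (by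
      rw [Set.uIcc_of_le (by linarith)]; rintro ⟨-, h⟩; linarith [hε.1]),
    hseg (x + ε) a (by linarith [hε.1]) (by linarith) le_rfl (by
      rw [Set.uIcc_of_le (by linarith)]; rintro ⟨h, -⟩; linarith [hε.1]),
    ← intervalIntegral.integral_interval_sub_left hk
      (hsub (-a) (x + ε) le_rfl (by linarith [hε.1]) (by linarith))]
  -- `Real.log` is even, so the terms `log ε` from the two sides cancel; this is where the symmetry
  -- of the truncation is used.
  rw [show x - ε - x = -ε by ring, show -a - x = -(a + x) by ring, show x + ε - x = ε by ring,
    Real.log_neg_eq_log, Real.log_neg_eq_log]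
  ring

theorem cauchyPV_eq {u : ℝ → ℝ} {x a : ℝ} (h1 : -a < x) (h2 : x < a)
    (hint : ∀ ε : ℝ, 0 < ε → IntegrableOn (fun r => u r / (r - x)) {r : ℝ | ε < |r - x|})
    (hk : IntervalIntegrable (fun r => (u r - u x) / (r - x)) volume (-a) a) :
    cauchyPV u x =
      (∫ r in (-a)..a, (u r - u x) / (r - x)) + u x * (Real.log (a - x) - Real.log (a + x)) +
        ∫ r in (Set.Icc (-a) a)ᶜ, u r / (r - x) :=
  (tendsto_truncatedCauchy h1 h2 hint hk).limUnder_eq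

/-- The contribution of the far part of the density is Lipschitz. -/
theorem exists_lipschitz_far {u : ℝ → ℝ} {a : ℝ} (ha : 0 < a)
    (hint : ∀ x ∈ Set.Ioc 0 (a / 2), ∀ ε : ℝ, 0 < ε →
      IntegrableOn (fun r => u r / (r - x)) {r : ℝ | ε < |r - x|}) :
    HolderNearZero fun x => ∫ r in (Set.Icc (-a) a)ᶜ, u r / (r - x) := by
  have ha2 : 0 < a / 2 := by positivity
  have hfar : ∀ x ∈ Set.Ioc 0 (a / 2), ∀ r ∈ (Set.Icc (-a) a)ᶜ, a / 2 ≤ |r - x| := by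
    intro x hx r hr
    rw [Set.mem_compl_iff, Set.mem_Icc, not_and_or, not_le, not_le] at hr
    rcases hr with h | h
    · exact le_abs.2 (Or.inr (by linarith [hx.1]))
    · exact le_abs.2 (Or.inl (by linarith [hx.2]))
  have hI : ∀ x ∈ Set.Ioc 0 (a / 2),
      IntegrableOn (fun r => u r / (r - x)) (Set.Icc (-a) a)ᶜ := fun x hx =>
    (hint x hx (a / 4) (by positivity)).mono_set fun r hr => by
      have := hfar x hx r hr
      show a / 4 < |r - x|
      linarith
  have hx0 : a / 2 ∈ Set.Ioc 0 (a / 2) := ⟨ha2, le_rfl⟩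
  -- The kernel at the reference point `a / 2` dominates: `|r - a/2| ≤ 2|r - x|` and `|r - y| ≥ a/2`
  -- on the far set give the constant `4 / a`, with no decay of `u` required beyond integrability of
  -- this one quotient.
  set N : ℝ := ∫ r in (Set.Icc (-a) a)ᶜ, |u r / (r - a / 2)|
  have hN : 0 ≤ N := integral_nonneg fun r => abs_nonneg _
  refine HolderNearZero.of_lipschitz ha2 (C := 4 / a * N) (by positivity) fun x hx y hy => ?_
  rw [← integral_sub (hI x hx) (hI y hy), ← Real.norm_eq_abs]
  calc ‖∫ r in (Set.Icc (-a) a)ᶜ, (u r / (r - x) - u r / (r - y))‖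
      ≤ ∫ r in (Set.Icc (-a) a)ᶜ, 4 / a * |x - y| * |u r / (r - a / 2)| := by
        refine norm_integral_le_of_norm_le ((hI _ hx0).abs.const_mul _) ?_
        filter_upwards [ae_restrict_mem (by measurability)] with r hr
        have f1 := hfar x hx r hr
        have f2 := hfar y hy r hr
        have f3 := hfar _ hx0 r hr
        have g1 : 0 < |r - x| := ha2.trans_le f1
        have g2 : 0 < |r - y| := ha2.trans_le f2
        have g3 : 0 < |r - a / 2| := ha2.trans_le f3
        have f4 : |r - a / 2| ≤ 2 * |r - x| := by
          have h5 : |r - a / 2| ≤ |r - x| + |x - a / 2| := by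
            simpa using abs_add_le (r - x) (x - a / 2)
          have h6 : |x - a / 2| ≤ a / 2 := by
            rw [abs_le]; constructor <;> linarith [hx.1, hx.2]
          linarith
        have e : u r / (r - x) - u r / (r - y) = u r * ((x - y) / ((r - x) * (r - y))) := by
          have := abs_pos.1 g1
          have := abs_pos.1 g2
          field_simp
          ring
        rw [Real.norm_eq_abs, e, abs_mul, abs_div, abs_mul, abs_div]
        calc |u r| * (|x - y| / (|r - x| * |r - y|))
            ≤ |u r| * (|x - y| / ((|r - a / 2| / 2) * (a / 2))) := by
              gcongr
              linarith
          _ = _ := by field_simp; ring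
    _ = _ := by
        rw [integral_const_mul]
        ring

/-! ### Logarithmic integrals -/

theorem integral_log_div {M : ℝ} (hM : 1 ≤ M) :
    ∫ t in (1 : ℝ)..M, Real.log t / t = Real.log M ^ 2 / 2 := by
  have hpos : ∀ t ∈ Set.uIcc 1 M, (0 : ℝ) < t := fun t ht => by
    rw [Set.uIcc_of_le hM] at ht; linarith [ht.1]
  rw [intervalIntegral.integral_eq_sub_of_hasDerivAt (f := fun t => Real.log t ^ 2 / 2)]
  · simp
  · intro t ht
    refine (((Real.hasDerivAt_log (hpos t ht).ne').pow 2).div_const 2).congr_deriv ?_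
    field_simp
    simp
  · refine ContinuousOn.intervalIntegrable (ContinuousOn.div ?_ continuousOn_id ?_)
    · exact Real.continuousOn_log.mono fun t ht => (hpos t ht).ne'
    · exact fun t ht => (hpos t ht).ne'

theorem intervalIntegrable_of_abs_le_rpow {κ : ℝ → ℝ} (hm : Measurable κ)
    (hb : ∀ t : ℝ, 0 < t → |κ t| ≤ 2 * t ^ (-1 / 2 : ℝ)) {M : ℝ} (hM : 0 ≤ M) :
    IntervalIntegrable κ volume 0 M := by
  refine ((intervalIntegral.intervalIntegrable_rpow' (r := -1 / 2) (by norm_num)).const_mul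
    2).mono_fun' hm.aestronglyMeasurable ?_
  rw [Set.uIoc_of_le hM]
  filter_upwards [ae_restrict_mem measurableSet_Ioc] with t ht using hb t ht.1

/-- The second bound improves the first by a factor `1 / t`, so `κ` differs from `log t / t` by `O(t
^ (-3/2))`, which is integrable at infinity; the comparison function integrates to `log² M / 2`. -/
theorem exists_tendsto_integral_sub_log_sq {κ : ℝ → ℝ} (hm : Measurable κ)
    (hb : ∀ t : ℝ, 0 < t → |κ t| ≤ 2 * t ^ (-1 / 2 : ℝ))
    (hb' : ∀ t : ℝ, 1 < t → |κ t - Real.log t / t| ≤ |κ t| / t) :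
    ∃ c : ℝ, Tendsto (fun M => (∫ t in (0 : ℝ)..M, κ t) - Real.log M ^ 2 / 2) atTop (𝓝 c) := by
  have hint : IntegrableOn (fun t => κ t - Real.log t / t) (Set.Ioi 1) := by
    refine Integrable.mono' ((integrableOn_Ioi_rpow_of_lt (a := -3 / 2) (by norm_num)
      one_pos).const_mul 2) (hm.sub (Real.measurable_log.div measurable_id)).aestronglyMeasurable ?_
    filter_upwards [ae_restrict_mem measurableSet_Ioi] with t ht
    have ht0 : (0 : ℝ) < t := one_pos.trans ht
    refine (hb' t ht).trans ?_
    rw [show (-3 / 2 : ℝ) = -1 / 2 - 1 by norm_num, Real.rpow_sub_one ht0.ne', ← mul_div_assoc]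
    exact div_le_div_of_nonneg_right (hb t ht0) ht0.le
  refine ⟨(∫ t in (0 : ℝ)..1, κ t) + ∫ t in Set.Ioi 1, (κ t - Real.log t / t), ?_⟩
  refine ((intervalIntegral_tendsto_integral_Ioi 1 hint tendsto_id).const_add _).congr' ?_
  filter_upwards [eventually_ge_atTop 1] with M hM
  have h1 := intervalIntegrable_of_abs_le_rpow hm hb zero_le_one
  have h2 := intervalIntegrable_of_abs_le_rpow hm hb (zero_le_one.trans hM)
  have h3 := h1.symm.trans h2
  have h4 : IntervalIntegrable (fun t : ℝ => Real.log t / t) volume 1 M := by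
    refine ContinuousOn.intervalIntegrable (ContinuousOn.div ?_ continuousOn_id ?_)
    · exact Real.continuousOn_log.mono fun t ht => by
        rw [Set.uIcc_of_le hM] at ht; exact (one_pos.trans_le ht.1).ne'
    · exact fun t ht => by
        rw [Set.uIcc_of_le hM] at ht; exact (one_pos.trans_le ht.1).ne'
  rw [id, intervalIntegral.integral_sub h3 h4, integral_log_div hM,
    ← intervalIntegral.integral_add_adjacent_intervals h1 h3]
  ring

/-- With `s = √t` one has `log t = 2 log s`, and `1 - 1/s ≤ log s ≤ s - 1` yields `s |log s| ≤ |s² -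
1|`. At `t = 1` the quotient is 0 by the convention for division by zero. -/
theorem abs_log_div_sub_one_le {t : ℝ} (ht : 0 < t) :
    |Real.log t / (t - 1)| ≤ 2 * t ^ (-1 / 2 : ℝ) := by
  rcases eq_or_ne t 1 with rfl | h1
  · simp
  have hs : 0 < √t := Real.sqrt_pos.2 ht
  have hsq : √t * √t = t := Real.mul_self_sqrt ht.le
  have hlog : Real.log t = 2 * Real.log √t := by rw [Real.log_sqrt ht.le]; ring
  have hpow : t ^ (-1 / 2 : ℝ) = (√t)⁻¹ := by
    rw [Real.sqrt_eq_rpow, ← Real.rpow_neg ht.le]; norm_num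
  rw [hpow, abs_div, div_le_iff₀ (abs_pos.2 (sub_ne_zero.2 h1)), hlog, mul_assoc, ← div_eq_inv_mul,
    abs_mul, abs_two]
  refine mul_le_mul_of_nonneg_left ?_ two_pos.le
  rw [le_div_iff₀ hs]
  have u1 := Real.log_le_sub_one_of_pos hs
  have u2 := Real.one_sub_inv_le_log_of_pos hs
  have u3 : √t * (√t)⁻¹ = 1 := mul_inv_cancel₀ hs.ne'
  rcases lt_or_gt_of_ne h1 with h | h
  · have hs1 : √t < 1 := by nlinarith
    rw [abs_of_neg (sub_neg.2 h), abs_of_nonpos (by linarith)]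
    nlinarith
  · have hs1 : 1 < √t := by nlinarith
    rw [abs_of_pos (sub_pos.2 h), abs_of_nonneg (Real.log_nonneg hs1.le)]
    nlinarith

theorem abs_log_div_add_one_le {t : ℝ} (ht : 0 < t) :
    |Real.log t / (t + 1)| ≤ 2 * t ^ (-1 / 2 : ℝ) := by
  rcases eq_or_ne t 1 with rfl | h1
  · simp
  refine le_trans ?_ (abs_log_div_sub_one_le ht)
  rw [abs_div, abs_div]
  refine div_le_div_of_nonneg_left (abs_nonneg _) (abs_pos.2 (sub_ne_zero.2 h1)) ?_
  rw [abs_of_pos (show 0 < t + 1 by linarith), abs_le]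
  constructor <;> linarith

/-- Rescaling turns the logarithmic Cauchy kernels into integrals of a fixed function. -/
theorem log_kernel_scaling {κ K : ℝ → ℝ} {x a : ℝ} (hx : 0 < x) (ha : 0 ≤ a)
    (hm : Measurable κ) (hb : ∀ t : ℝ, 0 < t → |κ t| ≤ 2 * t ^ (-1 / 2 : ℝ))
    (hK : ∀ r : ℝ, 0 < r → K r = x⁻¹ * κ (r / x)) :
    IntervalIntegrable K volume 0 a ∧ ∫ r in (0 : ℝ)..a, K r = ∫ t in (0 : ℝ)..(a / x), κ t := by
  constructor
  · have h1 := (intervalIntegrable_of_abs_le_rpow hm hb (M := a / x) (by positivity)).comp_mul_left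
      (c := x⁻¹)
    have h2 : IntervalIntegrable (fun r => κ (x⁻¹ * r)) volume 0 a := by
      simpa [hx.ne'] using h1
    refine (h2.const_mul x⁻¹).congr fun r hr => ?_
    rw [Set.uIoc_of_le ha] at hr
    simp only [hK r hr.1, div_eq_inv_mul]
  · rw [intervalIntegral.integral_congr_ae (g := fun r => x⁻¹ * κ (r / x))]
    · rw [intervalIntegral.integral_const_mul, intervalIntegral.integral_comp_div _ hx.ne']
      simp [hx.ne']
    · refine Eventually.of_forall fun r hr => ?_
      rw [Set.uIoc_of_le ha] at hr
      exact hK r hr.1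

theorem log_kernel_sub {x a : ℝ} (hx : 0 < x) (ha : 0 ≤ a) :
    IntervalIntegrable (fun r => (Real.log r - Real.log x) / (r - x)) volume 0 a ∧
      ∫ r in (0 : ℝ)..a, (Real.log r - Real.log x) / (r - x) =
        ∫ t in (0 : ℝ)..(a / x), Real.log t / (t - 1) := by
  refine log_kernel_scaling hx ha (Real.measurable_log.div (measurable_id.sub_const 1))
    (fun t ht => abs_log_div_sub_one_le ht) fun r hr => ?_
  rw [Real.log_div hr.ne' hx.ne', inv_mul_eq_div, div_div]
  congr 1
  field_simp

theorem log_kernel_add {x a : ℝ} (hx : 0 < x) (ha : 0 ≤ a) :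
    IntervalIntegrable (fun r => (Real.log r - Real.log x) / (r + x)) volume 0 a ∧
      ∫ r in (0 : ℝ)..a, (Real.log r - Real.log x) / (r + x) =
        ∫ t in (0 : ℝ)..(a / x), Real.log t / (t + 1) := by
  refine log_kernel_scaling hx ha (Real.measurable_log.div (measurable_id.add_const 1))
    (fun t ht => abs_log_div_add_one_le ht) fun r hr => ?_
  rw [Real.log_div hr.ne' hx.ne', inv_mul_eq_div, div_div]
  congr 1
  field_simp

theorem tendsto_div_nhdsGT_zero {a : ℝ} (ha : 0 < a) :
    Tendsto (fun x : ℝ => a / x) (𝓝[>] 0) atTop := by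
  simpa [div_eq_mul_inv] using tendsto_inv_nhdsGT_zero.const_mul_atTop ha

/-- The substitution `r = x t` moves all dependence on `x` into the upper limit `a / x`, which tends
to infinity as `x → 0+`; the square logarithm is that of `a / x`. -/
theorem exists_tendsto_log_kernel_sub {a : ℝ} (ha : 0 < a) :
    ∃ c : ℝ, Tendsto (fun x => (∫ r in (0 : ℝ)..a, (Real.log r - Real.log x) / (r - x)) -
      (Real.log a - Real.log x) ^ 2 / 2) (𝓝[>] 0) (𝓝 c) := by
  obtain ⟨c, hc⟩ := exists_tendsto_integral_sub_log_sq (κ := fun t => Real.log t / (t - 1))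
    (Real.measurable_log.div (measurable_id.sub_const 1)) (fun t ht => abs_log_div_sub_one_le ht)
    (fun t ht => by
      have h0 : t ≠ 0 := by linarith
      have h1 : t - 1 ≠ 0 := by linarith
      rw [← abs_of_pos (show 0 < t by linarith), ← abs_div, abs_of_pos (show 0 < t by linarith)]
      -- The difference `log t / (t - 1) - log t / t` is exactly the kernel divided by `t`.
      refine le_of_eq (congrArg _ ?_)
      field_simp
      ring)
  refine ⟨c, (hc.comp (tendsto_div_nhdsGT_zero ha)).congr' ?_⟩
  filter_upwards [self_mem_nhdsWithin] with x hx
  rw [Function.comp, (log_kernel_sub hx ha.le).2, Real.log_div ha.ne' (ne_of_gt hx)]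

theorem exists_tendsto_log_kernel_add {a : ℝ} (ha : 0 < a) :
    ∃ c : ℝ, Tendsto (fun x => (∫ r in (0 : ℝ)..a, (Real.log r - Real.log x) / (r + x)) -
      (Real.log a - Real.log x) ^ 2 / 2) (𝓝[>] 0) (𝓝 c) := by
  obtain ⟨c, hc⟩ := exists_tendsto_integral_sub_log_sq (κ := fun t => Real.log t / (t + 1))
    (Real.measurable_log.div (measurable_id.add_const 1)) (fun t ht => abs_log_div_add_one_le ht)
    (fun t ht => by
      have h0 : t ≠ 0 := by linarith
      have h1 : t + 1 ≠ 0 := by linarith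
      rw [← abs_of_pos (show 0 < t by linarith), ← abs_div, abs_of_pos (show 0 < t by linarith),
        ← abs_neg]
      refine le_of_eq (congrArg _ ?_)
      field_simp
      ring)
  refine ⟨c, (hc.comp (tendsto_div_nhdsGT_zero ha)).congr' ?_⟩
  filter_upwards [self_mem_nhdsWithin] with x hx
  rw [Function.comp, (log_kernel_add hx ha.le).2, Real.log_div ha.ne' (ne_of_gt hx)]

theorem HolderNearZero.of_contDiffAt {h : ℝ → ℝ} (hh : ContDiffAt ℝ 1 h 0) :
    HolderNearZero h := by
  obtain ⟨K, t, ht, hK⟩ := hh.exists_lipschitzOnWith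
  obtain ⟨b, hb, hbt⟩ := mem_nhdsGT_iff_exists_Ioc_subset.1 (mem_nhdsWithin_of_mem_nhds ht)
  exact HolderNearZero.of_lipschitz hb K.2 fun x hx y hy => by
    simpa [Real.dist_eq] using hK.dist_le_mul x (hbt hx) y (hbt hy)

/-- Mere convergence of `h` would not suffice: the rate `t ^ δ` is what absorbs the factor `log t`.
-/
theorem HolderNearZero.log_mul_tendsto {h : ℝ → ℝ} (hh : HolderNearZero h) :
    ∃ c : ℝ, Tendsto (fun t => Real.log t * h t - c * Real.log t) (𝓝[>] 0) (𝓝 0) := by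
  obtain ⟨a, C, δ, ha, -, hC, hδ, -, H⟩ := hh
  obtain ⟨c, hc⟩ := HolderNearZero.exists_limit ha hC hδ H
  refine ⟨c, ?_⟩
  have h1 : Tendsto (fun t : ℝ => C * |Real.log t * t ^ δ|) (𝓝[>] 0) (𝓝 0) := by
    simpa using (tendsto_log_mul_rpow_nhdsGT_zero hδ).abs.const_mul C
  refine squeeze_zero_norm' ?_ h1
  filter_upwards [HolderNearZero.eventually_Ioc ha] with t ht
  have h2 : 0 ≤ t ^ δ := Real.rpow_nonneg ht.1.le δ
  rw [Real.norm_eq_abs, show Real.log t * h t - c * Real.log t = Real.log t * (h t - c) by ring,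
    abs_mul, abs_mul, abs_of_nonneg h2]
  nlinarith [mul_le_mul_of_nonneg_left (hc t ht) (abs_nonneg (Real.log t))]

/-! ### Expansions at `0+` -/

/-- `F(t) = A ln t + h(t)` near `0+` with `h` Hölder continuous. -/
def LogHolderNearZero (F : ℝ → ℝ) : Prop :=
  ∃ A : ℝ, HolderNearZero fun t => F t - A * Real.log t

/-- `F(t) = B ln² t + C ln t + c + o(1)` as `t → 0+`. -/
def LogSqNearZero (F : ℝ → ℝ) : Prop :=
  ∃ B C c : ℝ, Tendsto (fun t => F t - (B * Real.log t ^ 2 + C * Real.log t)) (𝓝[>] 0) (𝓝 c)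

namespace LogHolderNearZero

variable {F G : ℝ → ℝ}

theorem of_holder (hF : HolderNearZero F) : LogHolderNearZero F :=
  ⟨0, hF.congr (Eventually.of_forall fun t => by simp)⟩

theorem add (hF : LogHolderNearZero F) (hG : LogHolderNearZero G) :
    LogHolderNearZero (fun t => F t + G t) := by
  obtain ⟨A, hA⟩ := hF
  obtain ⟨B, hB⟩ := hG
  exact ⟨A + B, (hA.add hB).congr (Eventually.of_forall fun t => by ring)⟩

theorem const_mul (r : ℝ) (hF : LogHolderNearZero F) : LogHolderNearZero (fun t => r * F t) := by
  obtain ⟨A, hA⟩ := hF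
  exact ⟨r * A, (hA.const_mul r).congr (Eventually.of_forall fun t => by ring)⟩

theorem congr (hF : LogHolderNearZero F) (he : F =ᶠ[𝓝[>] 0] G) : LogHolderNearZero G := by
  obtain ⟨A, hA⟩ := hF
  exact ⟨A, hA.congr (he.mono fun t ht => by simp only [ht])⟩

end LogHolderNearZero

namespace LogSqNearZero

variable {F G : ℝ → ℝ}

theorem add (hF : LogSqNearZero F) (hG : LogSqNearZero G) :
    LogSqNearZero (fun t => F t + G t) := by
  obtain ⟨B, C, c, h⟩ := hF
  obtain ⟨B', C', c', h'⟩ := hG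
  exact ⟨B + B', C + C', c + c', (h.add h').congr fun t => by ring⟩

theorem const_mul (r : ℝ) (hF : LogSqNearZero F) : LogSqNearZero (fun t => r * F t) := by
  obtain ⟨B, C, c, h⟩ := hF
  exact ⟨r * B, r * C, r * c, (h.const_mul r).congr fun t => by ring⟩

theorem congr (hF : LogSqNearZero F) (he : F =ᶠ[𝓝[>] 0] G) : LogSqNearZero G := by
  obtain ⟨B, C, c, h⟩ := hF
  exact ⟨B, C, c, h.congr' (he.mono fun t ht => by rw [ht])⟩

theorem of_tendsto {c : ℝ} (hF : Tendsto F (𝓝[>] 0) (𝓝 c)) : LogSqNearZero F :=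
  ⟨0, 0, c, by simpa using hF⟩

theorem of_logHolder (hF : LogHolderNearZero F) : LogSqNearZero F := by
  obtain ⟨A, hA⟩ := hF
  obtain ⟨c, hc⟩ := hA.exists_tendsto
  exact ⟨0, A, c, by simpa using hc⟩

theorem log : LogSqNearZero Real.log := ⟨0, 1, 0, by simp⟩

theorem log_sq : LogSqNearZero (fun t => Real.log t ^ 2) := ⟨1, 0, 0, by simp⟩

theorem log_mul_holder (hF : HolderNearZero F) : LogSqNearZero (fun t => Real.log t * F t) := by
  obtain ⟨c, hc⟩ := hF.log_mul_tendsto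
  exact ⟨0, c, 0, by simpa using hc⟩

theorem of_sub_log_sq {a c : ℝ}
    (h : Tendsto (fun x => F x - (Real.log a - Real.log x) ^ 2 / 2) (𝓝[>] 0) (𝓝 c)) :
    LogSqNearZero F :=
  ⟨1 / 2, -Real.log a, c + Real.log a ^ 2 / 2, (h.add_const _).congr fun t => by ring⟩

end LogSqNearZero

/-! ### Principal values of piecewise regular densities -/

/-- Removing the two one-sided limits makes both branches vanish at 0, so they join to a Hölder
function. Across 0, both `|s|` and `|t|` are at most `|s - t|`, whence the factor 2. The value at 0
is set to 0, since the germs say nothing about that point. -/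
theorem exists_glued_holder {h k : ℝ → ℝ} {a C δ : ℝ} (ha : 0 < a) (hC : 0 ≤ C) (hδ : 0 < δ)
    (H : ∀ s ∈ Set.Ioc 0 a, ∀ t ∈ Set.Ioc 0 a, |h s - h t| ≤ C * |s - t| ^ δ)
    (K : ∀ s ∈ Set.Ioc 0 a, ∀ t ∈ Set.Ioc 0 a, |k s - k t| ≤ C * |s - t| ^ δ) :
    ∃ (c d : ℝ) (v : ℝ → ℝ), (∀ t : ℝ, 0 < t → v t = h t - c) ∧
      (∀ t : ℝ, 0 < t → v (-t) = k t - d) ∧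
      ∀ s ∈ Set.Icc (-a) a, ∀ t ∈ Set.Icc (-a) a, |v s - v t| ≤ 2 * C * |s - t| ^ δ := by
  obtain ⟨c, hc⟩ := HolderNearZero.exists_limit ha hC hδ H
  obtain ⟨d, hd⟩ := HolderNearZero.exists_limit ha hC hδ K
  set v : ℝ → ℝ := fun r => if 0 < r then h r - c else if r < 0 then k (-r) - d else 0 with hv
  have hpos : ∀ t : ℝ, 0 < t → v t = h t - c := fun t ht => by simp [hv, ht]
  have hneg : ∀ t : ℝ, 0 < t → v (-t) = k t - d := fun t ht => by
    simp [hv, ht, not_lt.2 ht.le]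
  have hneg' : ∀ t : ℝ, t < 0 → v t = k (-t) - d := fun t ht => by
    simpa using hneg (-t) (by linarith)
  refine ⟨c, d, v, hpos, hneg, ?_⟩
  have hsize : ∀ r ∈ Set.Icc (-a) a, |v r| ≤ C * |r| ^ δ := by
    intro r hr
    rcases lt_trichotomy r 0 with h0 | h0 | h0
    · rw [hneg' r h0, abs_of_neg h0]
      exact hd (-r) ⟨by linarith, by linarith [hr.1]⟩
    · subst h0
      simp [hv, Real.zero_rpow hδ.ne']
    · rw [hpos r h0, abs_of_pos h0]
      exact hc r ⟨h0, hr.2⟩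
  intro s hs t ht
  have hnn : 0 ≤ C * |s - t| ^ δ := by positivity
  rcases le_or_gt (s * t) 0 with hst | hst
  · have h1 : |s| ≤ |s - t| := sq_le_sq.1 (by nlinarith [sq_nonneg t])
    have h2 : |t| ≤ |s - t| := sq_le_sq.1 (by nlinarith [sq_nonneg s])
    have h3 := (hsize s hs).trans (mul_le_mul_of_nonneg_left
      (Real.rpow_le_rpow (abs_nonneg _) h1 hδ.le) hC)
    have h4 := (hsize t ht).trans (mul_le_mul_of_nonneg_left
      (Real.rpow_le_rpow (abs_nonneg _) h2 hδ.le) hC)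
    linarith [abs_sub (v s) (v t)]
  · rcases pos_and_pos_or_neg_and_neg_of_mul_pos hst with ⟨h1, h2⟩ | ⟨h1, h2⟩
    · rw [hpos s h1, hpos t h2, sub_sub_sub_cancel_right]
      linarith [H s ⟨h1, hs.2⟩ t ⟨h2, ht.2⟩]
    · rw [hneg' s h1, hneg' t h2, sub_sub_sub_cancel_right]
      have h3 := K (-s) ⟨by linarith, by linarith [hs.1]⟩ (-t) ⟨by linarith, by linarith [ht.1]⟩
      rw [show -s - -t = -(s - t) by ring, abs_neg] at h3
      linarith

/-- On the right `u = Ar log r + cr + v` and on the left `u = Al log |r| + cl + v`, with one Hölder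
function `v` across 0. Everything coming from `v`, from the far part and from logarithms of `a ± x`
is Hölder; what remains is the jump of the constants and the logarithmic kernels. -/
theorem cauchyPV_expansion {u : ℝ → ℝ} {b Ar Al : ℝ} (hb : 0 < b)
    (hint : ∀ x ∈ Set.Ioc 0 b, ∀ ε : ℝ, 0 < ε →
      IntegrableOn (fun r => u r / (r - x)) {r : ℝ | ε < |r - x|})
    (hR : HolderNearZero fun t => u t - Ar * Real.log t)
    (hL : HolderNearZero fun t => u (-t) - Al * Real.log t) :
    ∃ (a J : ℝ) (H : ℝ → ℝ), 0 < a ∧ HolderNearZero H ∧ ∀ᶠ x in 𝓝[>] 0,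
      cauchyPV u x = J * Real.log x + H x
        + Ar * (∫ r in (0 : ℝ)..a, (Real.log r - Real.log x) / (r - x))
        - Al * (∫ r in (0 : ℝ)..a, (Real.log r - Real.log x) / (r + x))
        + (Al - Ar) * (Real.log x * (Real.log x - Real.log (a + x)))
        + Ar * (Real.log x * (Real.log (a - x) - Real.log (a + x))) := by
  obtain ⟨a, C, δ, ha, ha1, hab, hC, hδ, hδ1, hHR, hHL⟩ := hR.pair hL b hb
  obtain ⟨cr, cl, v, hvR, hvL, hv⟩ := exists_glued_holder ha hC hδ hHR hHL
  have hle : -a ≤ a := by linarith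
  have hle0 : -a ≤ 0 := by linarith
  have hmem : ∀ x ∈ Set.Ioc 0 (a / 2), x ∈ Set.Icc (-a) a := fun x hx =>
    ⟨by linarith [hx.1], by linarith [hx.2]⟩
  have hintx : ∀ x ∈ Set.Ioc 0 (a / 2), ∀ ε : ℝ, 0 < ε →
      IntegrableOn (fun r => u r / (r - x)) {r : ℝ | ε < |r - x|} := fun x hx =>
    hint x ⟨hx.1, by linarith [hx.2]⟩
  have hV : HolderNearZero fun x => ∫ r in (-a)..a, (v r - v x) / (r - x) := by
    obtain ⟨K, hK, hK'⟩ := holder_cauchyTransform ha (by positivity) hδ hδ1 hv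
    exact ⟨a / 2, K, δ / 2, by positivity, by linarith, hK, by positivity, by linarith,
      fun s hs t ht => hK' s (hmem s hs) t (hmem t ht)⟩
  have hv0 : HolderNearZero v :=
    ⟨a, 2 * C, δ, ha, ha1, by positivity, hδ, hδ1, fun s hs t ht =>
      hv s ⟨by linarith [hs.1], hs.2⟩ t ⟨by linarith [ht.1], ht.2⟩⟩
  have hlogp : HolderNearZero fun x => Real.log (a + x) :=
    HolderNearZero.of_contDiffAt (ContDiffAt.log (by fun_prop) (by simpa using ha.ne'))
  have hlogm : HolderNearZero fun x => Real.log (a - x) :=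
    HolderNearZero.of_contDiffAt (ContDiffAt.log (by fun_prop) (by simpa using ha.ne'))
  have hfar := exists_lipschitz_far ha hintx
  -- The coefficient `cl - cr` is the jump at 0, multiplied by `∫ dr / (r - x)` over `(-a, 0)`,
  -- which equals `log x - log (a + x)`.
  refine ⟨a, cl - cr, _, ha, ((hV.add (hlogp.const_mul (cr - cl))).add
    (((HolderNearZero.const cr).add hv0).mul (hlogm.sub hlogp))).add hfar, ?_⟩
  filter_upwards [HolderNearZero.eventually_Ioc (half_pos ha)] with x hx
  have hx0 : 0 < x := hx.1
  have hux : u x = Ar * Real.log x + cr + v x := by rw [hvR x hx0]; ring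
  obtain ⟨i1, -⟩ := log_kernel_sub hx0 ha.le
  obtain ⟨i2, -⟩ := log_kernel_add hx0 ha.le
  have ik := intervalIntegrable_kernel ha hδ hv (hmem x hx)
  have ikl : IntervalIntegrable (fun r => (v r - v x) / (r - x)) volume (-a) 0 :=
    ik.mono_set (by
      rw [Set.uIcc_of_le hle0, Set.uIcc_of_le hle]; exact Set.Icc_subset_Icc le_rfl ha.le)
  have ikr : IntervalIntegrable (fun r => (v r - v x) / (r - x)) volume 0 a :=
    ik.mono_set (by
      rw [Set.uIcc_of_le ha.le, Set.uIcc_of_le hle]; exact Set.Icc_subset_Icc hle0 le_rfl)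
  have i2' : IntervalIntegrable (fun r => (Real.log (-r) - Real.log x) / (-r + x)) volume
      (-a) 0 := by
    simpa using ((IntervalIntegrable.iff_comp_neg
      (f := fun r => (Real.log r - Real.log x) / (r + x))).1 i2).symm
  have i3 : IntervalIntegrable (fun r : ℝ => (r - x)⁻¹) volume (-a) 0 := by
    refine ContinuousOn.intervalIntegrable (ContinuousOn.inv₀ (by fun_prop) fun r hr hr0 => ?_)
    rw [Set.uIcc_of_le hle0] at hr
    linarith [hr.2]
  have e3 : ∫ r in (-a)..0, (r - x)⁻¹ = Real.log x - Real.log (a + x) := by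
    rw [integral_inv_sub (by
        rw [Set.uIcc_of_le (by linarith)]; rintro ⟨-, h⟩; linarith),
      zero_sub, Real.log_neg_eq_log, show -a - x = -(a + x) by ring, Real.log_neg_eq_log]
  have e2 : ∫ r in (-a)..0, (Real.log (-r) - Real.log x) / (-r + x) =
      ∫ r in (0 : ℝ)..a, (Real.log r - Real.log x) / (r + x) := by
    rw [intervalIntegral.integral_comp_neg (fun r => (Real.log r - Real.log x) / (r + x))]
    simp
  have er : ∀ r ∈ Set.uIoc 0 a, Ar * ((Real.log r - Real.log x) / (r - x)) +
      (v r - v x) / (r - x) = (u r - u x) / (r - x) := by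
    intro r hr
    rw [Set.uIoc_of_le ha.le] at hr
    rw [hux, hvR r hr.1]
    ring
  -- On the left, `u r - u x` leaves `(Al - Ar) log x + (cl - cr)` besides the matched differences,
  -- because `u x` is expanded with the right-hand coefficients. The point `r = 0` carries no
  -- information and is discarded as a null set.
  have el : ∀ r : ℝ, r ≠ 0 → r ∈ Set.uIoc (-a) 0 →
      -Al * ((Real.log (-r) - Real.log x) / (-r + x)) +
        ((Al - Ar) * Real.log x + (cl - cr)) * (r - x)⁻¹ + (v r - v x) / (r - x) =
          (u r - u x) / (r - x) := by
    intro r hr0 hr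
    rw [Set.uIoc_of_le hle0] at hr
    have hr1 : r < 0 := lt_of_le_of_ne hr.2 hr0
    have h1 := hvL (-r) (by linarith)
    rw [neg_neg] at h1
    rw [hux, h1, show -r + x = -(r - x) by ring]
    have : r - x ≠ 0 := by linarith
    field_simp
    ring
  have kr : IntervalIntegrable (fun r => (u r - u x) / (r - x)) volume 0 a :=
    ((i1.const_mul Ar).add ikr).congr er
  have ilsum := ((i2'.const_mul (-Al)).add
    (i3.const_mul ((Al - Ar) * Real.log x + (cl - cr)))).add ikl
  have kl : IntervalIntegrable (fun r => (u r - u x) / (r - x)) volume (-a) 0 := by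
    refine ilsum.congr_ae ?_
    filter_upwards [ae_restrict_mem measurableSet_uIoc,
      ae_restrict_of_ae (Measure.ae_ne volume 0)] with r h1 h2 using el r h2 h1
  rw [cauchyPV_eq (a := a) (by linarith) (by linarith [hx.2]) (hintx x hx) (kl.trans kr),
    ← intervalIntegral.integral_add_adjacent_intervals kl kr,
    ← intervalIntegral.integral_congr_ae (Eventually.of_forall er),
    ← intervalIntegral.integral_congr_ae (μ := volume)
      ((Measure.ae_ne volume (0 : ℝ)).mono el),
    intervalIntegral.integral_add (i1.const_mul Ar) ikr,
    intervalIntegral.integral_add ((i2'.const_mul (-Al)).add (i3.const_mul _)) ikl,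
    intervalIntegral.integral_add (i2'.const_mul (-Al)) (i3.const_mul _),
    intervalIntegral.integral_const_mul, intervalIntegral.integral_const_mul,
    intervalIntegral.integral_const_mul, e2, e3, hux,
    ← intervalIntegral.integral_add_adjacent_intervals ikl ikr]
  ring

/-- Without logarithms in the density only the jump term and the Hölder part of the expansion
survive. -/
theorem logHolder_cauchyPV_zero {u : ℝ → ℝ} {b : ℝ} (hb : 0 < b)
    (hint : ∀ x ∈ Set.Ioc 0 b, CauchyPVExists u x)
    (hR : HolderNearZero u) (hL : HolderNearZero fun t => u (-t)) :
    LogHolderNearZero (cauchyPV u) := by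
  obtain ⟨a, J, H, ha, hH, he⟩ := cauchyPV_expansion (Ar := 0) (Al := 0) hb
    (fun x hx => (hint x hx).1) (by simpa using hR) (by simpa using hL)
  refine ⟨J, hH.congr (he.mono fun x hx => ?_)⟩
  simp only [hx]
  ring

/-- Each logarithmic kernel contributes `log² x / 2` plus lower terms, and the mismatch `Al - Ar`
contributes another `log² x`; the other products are `log x` times a Hölder germ. -/
theorem logSq_cauchyPV_zero {u : ℝ → ℝ} {b : ℝ} (hb : 0 < b)
    (hint : ∀ x ∈ Set.Ioc 0 b, CauchyPVExists u x)
    (hR : LogHolderNearZero u) (hL : LogHolderNearZero fun t => u (-t)) :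
    LogSqNearZero (cauchyPV u) := by
  obtain ⟨Ar, hR⟩ := hR
  obtain ⟨Al, hL⟩ := hL
  obtain ⟨a, J, H, ha, hH, he⟩ := cauchyPV_expansion hb (fun x hx => (hint x hx).1) hR hL
  obtain ⟨c1, h1⟩ := exists_tendsto_log_kernel_sub ha
  obtain ⟨c2, h2⟩ := exists_tendsto_log_kernel_add ha
  have hlogp : HolderNearZero fun x => Real.log (a + x) :=
    HolderNearZero.of_contDiffAt (ContDiffAt.log (by fun_prop) (by simpa using ha.ne'))
  have hlogm : HolderNearZero fun x => Real.log (a - x) :=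
    HolderNearZero.of_contDiffAt (ContDiffAt.log (by fun_prop) (by simpa using ha.ne'))
  refine ((((((LogSqNearZero.log.const_mul J).add (.of_logHolder (.of_holder hH))).add
    ((LogSqNearZero.of_sub_log_sq h1).const_mul Ar)).add
    ((LogSqNearZero.of_sub_log_sq h2).const_mul (-Al))).add
    ((LogSqNearZero.log_sq.add ((LogSqNearZero.log_mul_holder hlogp).const_mul (-1))).const_mul
      (Al - Ar))).add
    ((LogSqNearZero.log_mul_holder (hlogm.sub hlogp)).const_mul Ar)).congr
    (he.mono fun x hx => ?_)
  rw [hx]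
  ring

/-! ### Change of variables -/

theorem measurePreserving_affine {e : ℝ} (he : e = 1 ∨ e = -1) (p : ℝ) :
    MeasurePreserving (fun t : ℝ => p + e * t) volume volume := by
  rcases he with rfl | rfl
  · simpa using measurePreserving_add_left volume p
  · simpa [Function.comp_def] using
      (measurePreserving_add_left volume p).comp (Measure.measurePreserving_neg volume)

theorem measurableEmbedding_affine {e : ℝ} (he : e = 1 ∨ e = -1) (p : ℝ) :
    MeasurableEmbedding (fun t : ℝ => p + e * t) := by
  refine Continuous.measurableEmbedding (by fun_prop) fun s t h => ?_
  rcases he with rfl | rfl <;> simpa using h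

/-- A reflection preserves the measure and the symmetric truncation but reverses the sign of the
kernel, which accounts for the factor `e`. -/
theorem CauchyPVExists.comp_affine {u : ℝ → ℝ} {e p t : ℝ} (he : e = 1 ∨ e = -1)
    (h : CauchyPVExists u (p + e * t)) :
    CauchyPVExists (fun t => u (p + e * t)) t ∧
      cauchyPV u (p + e * t) = e * cauchyPV (fun t => u (p + e * t)) t := by
  have hee : e * e = 1 := by rcases he with rfl | rfl <;> norm_num
  have habs : |e| = 1 := by rcases he with rfl | rfl <;> simp
  have hset : ∀ ε : ℝ, {r : ℝ | ε < |r - t|} =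
      (fun t : ℝ => p + e * t) ⁻¹' {r : ℝ | ε < |r - (p + e * t)|} := by
    intro ε
    ext r
    simp only [Set.mem_preimage, Set.mem_ofPred_eq]
    rw [show p + e * r - (p + e * t) = e * (r - t) by ring, abs_mul, habs, one_mul]
  have hfun : (fun r => u (p + e * r) / (r - t)) =
      fun r => e * ((fun y => u y / (y - (p + e * t))) (p + e * r)) := by
    funext r
    rcases he with rfl | rfl
    · simp
    · simp only
      rw [show p + -1 * r - (p + -1 * t) = -(r - t) by ring, div_neg]
      ring
  have htr : ∀ ε : ℝ, truncatedCauchy (fun t => u (p + e * t)) t ε =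
      e * truncatedCauchy u (p + e * t) ε := by
    intro ε
    rw [truncatedCauchy, truncatedCauchy, hfun, integral_const_mul, hset,
      (measurePreserving_affine he p).setIntegral_preimage_emb (measurableEmbedding_affine he p)
        (fun y => u y / (y - (p + e * t)))]
  obtain ⟨h1, V, hV⟩ := h
  have hV' : Tendsto (truncatedCauchy (fun t => u (p + e * t)) t) (𝓝[>] 0) (𝓝 (e * V)) :=
    (hV.const_mul e).congr fun ε => (htr ε).symm
  refine ⟨⟨fun ε hε => ?_, e * V, hV'⟩, ?_⟩
  · rw [hfun, hset]
    exact (((measurePreserving_affine he p).integrableOn_comp_preimage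
      (measurableEmbedding_affine he p)).2 (h1 ε hε)).const_mul e
  · rw [cauchyPV, cauchyPV, hV.limUnder_eq, hV'.limUnder_eq, ← mul_assoc, hee, one_mul]

theorem logHolder_cauchyPV {u : ℝ → ℝ} {b e d p : ℝ} (he : e = 1 ∨ e = -1) (hd : d = -e)
    (hb : 0 < b)
    (hint : ∀ t ∈ Set.Ioc 0 b, CauchyPVExists u (p + e * t))
    (hR : HolderNearZero fun t => u (p + e * t)) (hL : HolderNearZero fun t => u (p + d * t)) :
    LogHolderNearZero fun t => cauchyPV u (p + e * t) := by
  refine ((logHolder_cauchyPV_zero hb (fun t ht => ((hint t ht).comp_affine he).1) hR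
    (by simpa [hd] using hL)).const_mul e).congr ?_
  filter_upwards [HolderNearZero.eventually_Ioc hb] with t ht
  exact ((hint t ht).comp_affine he).2.symm

theorem logSq_cauchyPV {u : ℝ → ℝ} {b e d p : ℝ} (he : e = 1 ∨ e = -1) (hd : d = -e)
    (hb : 0 < b)
    (hint : ∀ t ∈ Set.Ioc 0 b, CauchyPVExists u (p + e * t))
    (hR : LogHolderNearZero fun t => u (p + e * t))
    (hL : LogHolderNearZero fun t => u (p + d * t)) :
    LogSqNearZero fun t => cauchyPV u (p + e * t) := by
  refine ((logSq_cauchyPV_zero hb (fun t ht => ((hint t ht).comp_affine he).1) hR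
    (by simpa [hd] using hL)).const_mul e).congr ?_
  filter_upwards [HolderNearZero.eventually_Ioc hb] with t ht
  exact ((hint t ht).comp_affine he).2.symm

/-! ### Logarithmic expansions exclude power singularities -/

/-- The second differences are constantly `2c` and tend to 0; once `c = 0`, the same holds for the
first differences and `b`. -/
theorem eq_of_tendsto_quadratic {a b c z : ℝ}
    (h : Tendsto (fun n : ℕ => a + b * n + c * (n : ℝ) ^ 2) atTop (𝓝 z)) :
    a = z ∧ b = 0 ∧ c = 0 := by
  have h1 := h.comp (tendsto_add_atTop_nat 1)
  have h2 := h.comp (tendsto_add_atTop_nat 2)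
  have hc : c = 0 := by
    have h3 := (h2.sub (h1.const_mul 2)).add h
    have h4 : Tendsto (fun _ : ℕ => 2 * c) atTop (𝓝 (z - 2 * z + z)) :=
      h3.congr fun n => by simp only [Function.comp]; push_cast; ring
    have := tendsto_nhds_unique h4 tendsto_const_nhds
    linarith
  have hb : b = 0 := by
    have h4 : Tendsto (fun _ : ℕ => b) atTop (𝓝 (z - z)) :=
      (h1.sub h).congr fun n => by simp only [Function.comp, hc]; push_cast; ring
    have := tendsto_nhds_unique h4 tendsto_const_nhds
    linarith
  refine ⟨?_, hb, hc⟩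
  simpa [hb, hc] using h

theorem re_mul_cpow {A γ : ℂ} {t : ℝ} (ht : 0 < t) :
    (A * (t : ℂ) ^ γ).re = t ^ γ.re *
      (A.re * Real.cos (γ.im * Real.log t) - A.im * Real.sin (γ.im * Real.log t)) := by
  rw [Complex.cpow_def_of_ne_zero (by exact_mod_cast ht.ne'), ← Complex.ofReal_log ht.le,
    Complex.mul_re, Complex.exp_re, Complex.exp_im, Complex.re_ofReal_mul, Complex.im_ofReal_mul,
    Real.rpow_def_of_pos ht, mul_comm γ.im]
  ring

theorem exists_period (A : ℂ) (η : ℝ) :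
    ∃ κ : ℝ, 0 < κ ∧ ∀ x : ℝ,
      (∀ n : ℕ, A.re * Real.cos (η * (x - n * κ)) - A.im * Real.sin (η * (x - n * κ)) =
        A.re * Real.cos (η * x) - A.im * Real.sin (η * x)) ∧
      (η ≠ 0 → A.re * Real.cos (η * (x + κ / 2)) - A.im * Real.sin (η * (x + κ / 2)) =
        -(A.re * Real.cos (η * x) - A.im * Real.sin (η * x))) := by
  have hπ := Real.pi_pos
  rcases lt_trichotomy η 0 with h | h | h
  · refine ⟨2 * Real.pi / -η, div_pos (by positivity) (by linarith), fun x => ⟨fun n => ?_, fun _ => ?_⟩⟩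
    · rw [show η * (x - n * (2 * Real.pi / -η)) = η * x + n * (2 * Real.pi) by
        have := h.ne; rw [div_neg]; field_simp; ring,
        Real.cos_add_nat_mul_two_pi, Real.sin_add_nat_mul_two_pi]
    · rw [show η * (x + 2 * Real.pi / -η / 2) = η * x - Real.pi by field_simp; ring,
        Real.cos_sub_pi, Real.sin_sub_pi]
      ring
  · subst h
    exact ⟨1, one_pos, fun x => ⟨fun n => by simp, fun h => absurd rfl h⟩⟩
  · refine ⟨2 * Real.pi / η, by positivity, fun x => ⟨fun n => ?_, fun _ => ?_⟩⟩
    · rw [show η * (x - n * (2 * Real.pi / η)) = η * x - n * (2 * Real.pi) by field_simp,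
        Real.cos_sub_nat_mul_two_pi, Real.sin_sub_nat_mul_two_pi]
    · rw [show η * (x + 2 * Real.pi / η / 2) = η * x + Real.pi by field_simp,
        Real.cos_add_pi, Real.sin_add_pi]
      ring

theorem LogSqNearZero.rpow_mul_tendsto {G : ℝ → ℝ} (hG : LogSqNearZero G) {s : ℝ} (hs : 0 < s) :
    Tendsto (fun t => t ^ s * G t) (𝓝[>] 0) (𝓝 0) := by
  obtain ⟨B, C, c, h⟩ := hG
  have h0 : Tendsto (fun t : ℝ => t ^ s) (𝓝[>] 0) (𝓝 0) := by
    have : Tendsto (fun t : ℝ => t) (𝓝[>] 0) (𝓝 0) := nhdsWithin_le_nhds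
    simpa [Real.zero_rpow hs.ne'] using this.rpow_const (p := s) (Or.inr hs.le)
  have h1 := tendsto_log_mul_rpow_nhdsGT_zero hs
  -- The power is split as `t ^ (s/2) * t ^ (s/2)`, one factor for each logarithm in `log²`.
  have h2 := (tendsto_log_mul_rpow_nhdsGT_zero (half_pos hs)).pow 2
  have h3 := ((h0.mul h).add (h1.const_mul C)).add (h2.const_mul B)
  simp only [zero_mul, mul_zero, add_zero, ne_eq, OfNat.ofNat_ne_zero, not_false_eq_true,
    zero_pow] at h3
  refine h3.congr' ?_
  filter_upwards [self_mem_nhdsWithin] with t ht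
  have ht0 : (0 : ℝ) < t := ht
  have h4 : t ^ s = t ^ (s / 2) * t ^ (s / 2) := by rw [← Real.rpow_add ht0, add_halves]
  rw [h4]
  ring

/-- Divided by `t ^ Re γ`, the power term becomes a trigonometric function `g` of `log t`. Sampling
`t` along a geometric sequence that shifts `log t` by whole periods freezes `g`, so its value can be
compared with the limit of the rest. -/
theorem LogSqNearZero.re_cpow_eq_zero {G : ℝ → ℝ} (hG : LogSqNearZero G) {γ A : ℂ}
    (hγ : γ.re ≤ 0) (hγ0 : γ ≠ 0)
    (h : (fun t : ℝ => G t - (A * (t : ℂ) ^ γ).re) =o[𝓝[>] 0] fun t => t ^ γ.re) {r : ℝ}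
    (hr : 0 < r) : (A * (r : ℂ) ^ γ).re = 0 := by
  rw [re_mul_cpow hr]
  set g : ℝ → ℝ := fun x => A.re * Real.cos (γ.im * x) - A.im * Real.sin (γ.im * x) with hg
  suffices hz : g (Real.log r) = 0 by
    rw [show A.re * Real.cos (γ.im * Real.log r) - A.im * Real.sin (γ.im * Real.log r) =
      g (Real.log r) from rfl, hz, mul_zero]
  have hdiff : Tendsto (fun t => t ^ (-γ.re) * G t - g (Real.log t)) (𝓝[>] 0) (𝓝 0) := by
    refine h.tendsto_div_nhds_zero.congr' ?_
    filter_upwards [self_mem_nhdsWithin] with t ht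
    have ht0 : (0 : ℝ) < t := ht
    have hp := Real.rpow_pos_of_pos ht0 γ.re
    rw [re_mul_cpow ht0, Real.rpow_neg ht0.le]
    simp only [hg]
    field_simp
  obtain ⟨κ, hκ, hper⟩ := exists_period A γ.im
  have hseq : ∀ x : ℝ, Tendsto (fun n : ℕ => Real.exp (x - n * κ)) atTop (𝓝[>] 0) := by
    intro x
    refine tendsto_nhdsWithin_iff.2 ⟨?_, Eventually.of_forall fun n => Real.exp_pos _⟩
    refine Real.tendsto_exp_atBot.comp ?_
    exact tendsto_atBot_add_const_left _ x
      (tendsto_neg_atTop_atBot.comp (tendsto_natCast_atTop_atTop.atTop_mul_const hκ))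
  -- For `Re γ < 0` the logarithms are killed by `t ^ (-Re γ)`, so `g` tends to 0 and, being
  -- periodic, vanishes.
  rcases hγ.lt_or_eq with hneg | hzero
  · have h1 : Tendsto (fun t => g (Real.log t)) (𝓝[>] 0) (𝓝 0) := by
      simpa using (hG.rpow_mul_tendsto (neg_pos.2 hneg)).sub hdiff
    have h2 := h1.comp (hseq (Real.log r))
    refine tendsto_nhds_unique (tendsto_const_nhds (f := (atTop : Filter ℕ))) (h2.congr fun n => ?_)
    rw [Function.comp, Real.log_exp]
    exact (hper (Real.log r)).1 n
  · have hη : γ.im ≠ 0 := fun hi => hγ0 (Complex.ext hzero hi)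
    obtain ⟨B, C, c, hc⟩ := hG
    have h1 : Tendsto (fun t => g (Real.log t) - (B * Real.log t ^ 2 + C * Real.log t))
        (𝓝[>] 0) (𝓝 c) := by
      have := hc.sub hdiff
      rw [sub_zero] at this
      refine this.congr fun t => ?_
      rw [hzero, neg_zero, Real.rpow_zero]
      ring
    -- For `Re γ = 0` the samples form a convergent quadratic polynomial in `n`. This forces `B = C
    -- = 0` and makes `g` constant; a half-period shift changes its sign, so the constant is 0.
    have hB : ∀ x : ℝ, g x - B * x ^ 2 - C * x = c ∧ 2 * B * x * κ + C * κ = 0 ∧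
        -(B * κ ^ 2) = 0 := by
      intro x
      refine eq_of_tendsto_quadratic ((h1.comp (hseq x)).congr fun n => ?_)
      rw [Function.comp, Real.log_exp, show g (x - n * κ) = g x from (hper x).1 n]
      ring
    have hB0 : B = 0 := by
      have := (hB 0).2.2
      have hk : κ ^ 2 ≠ 0 := by positivity
      simpa [hk, hκ.ne'] using this
    have hC0 : C = 0 := by
      have := (hB 0).2.1
      simpa [hB0, hκ.ne'] using this
    have e1 := (hB (Real.log r)).1
    have e2 := (hB (Real.log r + κ / 2)).1
    have e3 : g (Real.log r + κ / 2) = -g (Real.log r) := (hper (Real.log r)).2 hη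
    rw [hB0, hC0] at e1 e2
    linarith

/-! ### One-sided neighbourhoods of a tip -/

/-- Near `p` the set `S` is exactly one open ray, and `x ↦ e * (x - p)` inverts the parametrisation
because `e * e = 1`. Limits at a tip thereby become limits at `0+`. -/
theorem nhdsWithin_eq_map_affine {S : Set ℝ} {p e b : ℝ} (he : e = 1 ∨ e = -1) (hb : 0 < b)
    (hS : ∀ t : ℝ, 0 < t → t < b → p + e * t ∈ S)
    (hS' : ∀ t : ℝ, 0 ≤ t → t < b → p - e * t ∉ S) :
    𝓝[S] p = map (fun t => p + e * t) (𝓝[>] 0) := by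
  have hee : e * e = 1 := by rcases he with rfl | rfl <;> norm_num
  refine le_antisymm (le_map_of_right_inverse (mba := fun x => e * (x - p)) ?_ ?_) ?_
  · refine Eventually.of_forall fun x => ?_
    simp only [Function.comp, id]
    rw [← mul_assoc, hee]
    ring
  · refine tendsto_nhdsWithin_iff.2 ⟨?_, ?_⟩
    · have : Continuous fun x : ℝ => e * (x - p) := by fun_prop
      simpa using (this.tendsto p).mono_left nhdsWithin_le_nhds
    · filter_upwards [self_mem_nhdsWithin,
        mem_nhdsWithin_of_mem_nhds (Metric.ball_mem_nhds p hb)] with x hx hxb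
      by_contra hcon
      rw [Set.mem_Ioi, not_lt] at hcon
      refine hS' (-(e * (x - p))) (by linarith) ?_ ?_
      · rw [Metric.mem_ball, Real.dist_eq, abs_lt] at hxb
        rcases he with rfl | rfl <;> linarith [hxb.1, hxb.2]
      · rw [mul_neg, ← mul_assoc, hee]
        simpa using hx
  · refine tendsto_nhdsWithin_iff.2 ⟨?_, ?_⟩
    · have : Continuous fun t : ℝ => p + e * t := by fun_prop
      simpa using (this.tendsto 0).mono_left nhdsWithin_le_nhds
    · filter_upwards [Ioo_mem_nhdsGT hb] with t ht using hS t ht.1 ht.2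

section Side

variable {F : ℝ → ℝ} {S : Set ℝ} {p e : ℝ}

theorem abs_affine_sub (he : e = 1 ∨ e = -1) {t : ℝ} (ht : 0 < t) : |p + e * t - p| = t := by
  rcases he with rfl | rfl <;> simp [abs_of_pos ht]

theorem hasLogExpansion_of_side (he : e = 1 ∨ e = -1)
    (hS : 𝓝[S] p = map (fun t => p + e * t) (𝓝[>] 0))
    (h : LogHolderNearZero fun t => F (p + e * t)) : HasLogExpansion F p (𝓝[S] p) := by
  obtain ⟨A, hA⟩ := h
  obtain ⟨c, hc⟩ := hA.exists_tendsto
  refine ⟨A, c, ?_⟩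
  rw [hS, tendsto_map'_iff]
  refine hc.congr' ?_
  filter_upwards [self_mem_nhdsWithin] with t ht
  rw [Function.comp, abs_affine_sub he ht]

theorem hasLogSqExpansion_of_side (he : e = 1 ∨ e = -1)
    (hS : 𝓝[S] p = map (fun t => p + e * t) (𝓝[>] 0))
    (h : LogSqNearZero fun t => F (p + e * t)) : HasLogSqExpansion F p (𝓝[S] p) := by
  obtain ⟨B, C, c, hc⟩ := h
  refine ⟨B, C, c, ?_⟩
  rw [hS, tendsto_map'_iff]
  refine hc.congr' ?_
  filter_upwards [self_mem_nhdsWithin] with t ht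
  rw [Function.comp, abs_affine_sub he ht]

theorem boundedAlong_of_side (hS : 𝓝[S] p = map (fun t => p + e * t) (𝓝[>] 0))
    (h : HolderNearZero fun t => F (p + e * t)) : BoundedAlong F (𝓝[S] p) := by
  obtain ⟨c, hc⟩ := h.exists_tendsto
  rw [BoundedAlong, hS, isBigO_map]
  exact hc.isBigO_one ℝ

theorem not_hasPowerSingularity_of_side (he : e = 1 ∨ e = -1)
    (hS : 𝓝[S] p = map (fun t => p + e * t) (𝓝[>] 0))
    (h : LogSqNearZero fun t => F (p + e * t)) : ¬ HasPowerSingularity F p (𝓝[S] p) := by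
  rintro ⟨γ, A, -, hγ, hγ0, ⟨r, hr, hne⟩, ho⟩
  rw [hS, isLittleO_map] at ho
  refine hne (h.re_cpow_eq_zero hγ hγ0 (ho.congr' ?_ ?_) hr) <;>
  · filter_upwards [self_mem_nhdsWithin] with t ht
    rw [Function.comp, abs_affine_sub he ht]

theorem holderNearZero_of_deriv (he : e = 1 ∨ e = -1) (hopen : IsOpen S)
    (hS : 𝓝[S] p = map (fun t => p + e * t) (𝓝[>] 0)) (hF : DifferentiableOn ℝ F S)
    (h : AtMostIntegrablePower (deriv F) p (𝓝[S] p)) :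
    HolderNearZero fun t => F (p + e * t) := by
  obtain ⟨s, hs, hO⟩ := h
  have hmem : ∀ᶠ t in 𝓝[>] (0 : ℝ), p + e * t ∈ S := by
    have : ∀ᶠ x in 𝓝[S] p, x ∈ S := self_mem_nhdsWithin
    rwa [hS, eventually_map] at this
  have hderiv : ∀ᶠ t in 𝓝[>] (0 : ℝ),
      HasDerivAt (fun t => F (p + e * t)) (e * deriv F (p + e * t)) t := by
    filter_upwards [hmem] with t ht
    have h1 : HasDerivAt F (deriv F (p + e * t)) (p + e * t) :=
      (hF.differentiableAt (hopen.mem_nhds ht)).hasDerivAt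
    have h2 : HasDerivAt (fun t : ℝ => p + e * t) e t := by
      simpa using ((hasDerivAt_id t).const_mul e).const_add p
    exact (h1.comp t h2).congr_deriv (mul_comm _ _)
  refine HolderNearZero.of_deriv_isBigO hs (hderiv.mono fun t ht => ht.differentiableAt) ?_
  rw [hS, isBigO_map] at hO
  refine (hO.const_mul_left e).congr' (hderiv.mono fun t ht => ht.deriv.symm) ?_
  filter_upwards [self_mem_nhdsWithin] with t ht
  rw [Function.comp, abs_affine_sub he ht]

/-- A Hölder germ is bounded, so the exponent 0 serves; this allows the integration step to be
repeated, from `ψ'` to `ψ`. -/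
theorem atMostIntegrablePower_of_side (hS : 𝓝[S] p = map (fun t => p + e * t) (𝓝[>] 0))
    (h : HolderNearZero fun t => F (p + e * t)) : AtMostIntegrablePower F p (𝓝[S] p) := by
  refine ⟨0, by norm_num, ?_⟩
  simpa [BoundedAlong] using boundedAlong_of_side hS h

theorem holderNearZero_of_holderOnWith {C s : ℝ≥0} {b : ℝ} (he : e = 1 ∨ e = -1) (hs : 0 < s)
    (hb : 0 < b) (hS : ∀ t ∈ Set.Ioc 0 b, p + e * t ∈ S) (h : HolderOnWith C s F S) :
    HolderNearZero fun t => F (p + e * t) := by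
  have hs' : (0 : ℝ) < s := hs
  have hm : 0 < min (s : ℝ) 1 := lt_min hs' one_pos
  refine ⟨min b 1, C, min s 1, by positivity, min_le_right _ _, C.2, hm, min_le_right _ _,
    fun x hx y hy => ?_⟩
  have h1 := h.dist_le (hS x ⟨hx.1, hx.2.trans (min_le_left _ _)⟩)
    (hS y ⟨hy.1, hy.2.trans (min_le_left _ _)⟩)
  have h2 : |p + e * x - (p + e * y)| = |x - y| := by
    rw [show p + e * x - (p + e * y) = e * (x - y) by ring, abs_mul]
    rcases he with rfl | rfl <;> simp
  rw [Real.dist_eq, Real.dist_eq, h2] at h1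
  exact h1.trans (mul_le_mul_of_nonneg_left
    (HolderNearZero.abs_sub_rpow_le (min_le_right _ _) hx hy hm (min_le_left _ _)) C.2)

end Side

/-! ### The elastic constants and the geometry of the crack -/

theorem Material.Admissible.alpha_pos {m : Material} (hm : m.Admissible) : 0 < m.alpha := by
  have h1 := hm.mu_pos
  have h2 := hm.lam_add_mu_pos
  exact div_pos (by positivity) (by linarith)

namespace Problem

variable (P : Problem)

theorem isOpen_crack : IsOpen P.crack := isOpen_lt continuous_abs continuous_const

theorem isOpen_bonded : IsOpen P.bonded := isOpen_lt continuous_const continuous_abs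

variable {P} {e d p : ℝ}

theorem mem_crack_side (he : e = 1 ∨ e = -1) (hd : d = -e) (hp : p = e * P.l) {t : ℝ}
    (h0 : 0 < t) (ht : t < 2 * P.l) : p + d * t ∈ P.crack := by
  subst hd hp
  show |_| < P.l
  rw [abs_lt]
  rcases he with rfl | rfl <;> constructor <;> linarith

theorem mem_bonded_side (he : e = 1 ∨ e = -1) (hp : p = e * P.l) {t : ℝ} (h0 : 0 < t) :
    p + e * t ∈ P.bonded := by
  subst hp
  show P.l < |_|
  rw [lt_abs]
  rcases he with rfl | rfl
  · left; linarith
  · right; linarith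

theorem nhdsWithin_crack (hl : 0 < P.l) (he : e = 1 ∨ e = -1) (hd : d = -e) (hp : p = e * P.l) :
    𝓝[P.crack] p = map (fun t => p + d * t) (𝓝[>] 0) := by
  have hd' : d = 1 ∨ d = -1 := by rcases he with rfl | rfl <;> simp [hd]
  refine nhdsWithin_eq_map_affine hd' hl (fun t h0 ht => mem_crack_side he hd hp h0 (by linarith))
    fun t h0 ht hmem => ?_
  subst hd hp
  have : |_| < P.l := hmem
  rw [abs_lt] at this
  rcases he with rfl | rfl <;> linarith [this.1, this.2]

theorem nhdsWithin_bonded (hl : 0 < P.l) (he : e = 1 ∨ e = -1) (hp : p = e * P.l) :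
    𝓝[P.bonded] p = map (fun t => p + e * t) (𝓝[>] 0) := by
  refine nhdsWithin_eq_map_affine he hl (fun t h0 _ => mem_bonded_side he hp h0)
    fun t h0 ht hmem => ?_
  subst hp
  have : P.l < |_| := hmem
  rw [lt_abs] at this
  rcases he with rfl | rfl <;> rcases this with h | h <;> linarith

/-! ### The unknowns and the stresses near a tip -/

/-- The behaviour of a solution near a tip `p`, along the direction `d` of the crack and along the
direction `e` of the bonded interface. -/
structure TipRegular (P : Problem) (w : Unknowns) (p e d : ℝ) : Prop where
  phi1 : LogHolderNearZero fun t => w.phi1 (p + d * t)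
  phi2 : LogHolderNearZero fun t => w.phi2 (p + d * t)
  phi : LogHolderNearZero fun t => w.phi (p + e * t)
  psi1 : HolderNearZero fun t => w.psi1 (p + d * t)
  psi2 : HolderNearZero fun t => w.psi2 (p + d * t)
  psi : HolderNearZero fun t => w.psi (p + e * t)
  psi1_d : HolderNearZero fun t => deriv w.psi1 (p + d * t)
  psi2_d : HolderNearZero fun t => deriv w.psi2 (p + d * t)
  psi_d : HolderNearZero fun t => deriv w.psi (p + e * t)
  psi1_dd : LogSqNearZero fun t => deriv (deriv w.psi1) (p + d * t)
  psi2_dd : LogSqNearZero fun t => deriv (deriv w.psi2) (p + d * t)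
  psi_dd : LogSqNearZero fun t => deriv (deriv w.psi) (p + e * t)
  sigma12p_crack : LogSqNearZero fun t => P.totalSigma12p w (p + d * t)
  sigma12m_crack : LogSqNearZero fun t => P.totalSigma12m w (p + d * t)
  sigma12p_bonded : LogSqNearZero fun t => P.totalSigma12p w (p + e * t)
  sigma12m_bonded : LogSqNearZero fun t => P.totalSigma12m w (p + e * t)
  sigma22p_crack : HolderNearZero fun t => P.totalSigma22p w (p + d * t)
  sigma22m_crack : HolderNearZero fun t => P.totalSigma22m w (p + d * t)
  sigma22_jump_bonded : HolderNearZero fun t =>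
    P.totalSigma22p w (p + e * t) - P.totalSigma22m w (p + e * t)
  sigma22p_bonded : LogHolderNearZero fun t => P.totalSigma22p w (p + e * t)
  sigma22m_bonded : LogHolderNearZero fun t => P.totalSigma22m w (p + e * t)

theorem tipRegular {w : Unknowns} (hP : P.Admissible) (hγp : P.gamma1p ≠ 0)
    (hγm : P.gamma1m ≠ 0) (hγi : P.gamma1i ≠ 0) (hw : P.IsSolution w)
    (hpow : P.AtMostPowerAtTips w) (he : e = 1 ∨ e = -1) (hd : d = -e) (hp : p = e * P.l) :
    TipRegular P w p e d := by
  have hl := hP.l_pos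
  have hd' : d = 1 ∨ d = -1 := by rcases he with rfl | rfl <;> simp [hd]
  have hed : e = -d := by rw [hd, neg_neg]
  have habs : |p| = P.l := by
    rw [hp, abs_mul, abs_of_pos hl]; rcases he with rfl | rfl <;> simp
  have hcr := nhdsWithin_crack hl he hd hp
  have hbo := nhdsWithin_bonded hl he hp
  have mcr : ∀ t ∈ Set.Ioc 0 P.l, p + d * t ∈ P.crack := fun t ht =>
    mem_crack_side he hd hp ht.1 (by linarith [ht.2])
  have mbo : ∀ t ∈ Set.Ioc 0 P.l, p + e * t ∈ P.bonded := fun t ht => mem_bonded_side he hp ht.1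
  have ncr : ∀ t ∈ Set.Ioc 0 P.l, |p + d * t| ≠ P.l := fun t ht => ne_of_lt (mcr t ht)
  have nbo : ∀ t ∈ Set.Ioc 0 P.l, |p + e * t| ≠ P.l := fun t ht => ne_of_gt (mbo t ht)
  have gin : ∀ f g : ℝ → ℝ, ∀ t ∈ Set.Ioc 0 P.l, glue P.l f g (p + d * t) = f (p + d * t) :=
    fun f g t ht => if_pos (mcr t ht)
  have gout : ∀ f g : ℝ → ℝ, ∀ t ∈ Set.Ioc 0 P.l, glue P.l f g (p + e * t) = g (p + e * t) :=
    fun f g t ht => if_neg (not_lt.2 (le_of_lt (mbo t ht)))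
  have hIoc := HolderNearZero.eventually_Ioc hl
  have gin' : ∀ f g : ℝ → ℝ, (fun t => f (p + d * t)) =ᶠ[𝓝[>] 0]
      fun t => glue P.l f g (p + d * t) := fun f g => hIoc.mono fun t ht => (gin f g t ht).symm
  have gout' : ∀ f g : ℝ → ℝ, (fun t => g (p + e * t)) =ᶠ[𝓝[>] 0]
      fun t => glue P.l f g (p + e * t) := fun f g => hIoc.mono fun t ht => (gout f g t ht).symm
  have psi1_d := holderNearZero_of_deriv hd' P.isOpen_crack hcr hw.diff_psi1.2 (hpow.psi1 p habs)
  have psi2_d := holderNearZero_of_deriv hd' P.isOpen_crack hcr hw.diff_psi2.2 (hpow.psi2 p habs)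
  have psi_d := holderNearZero_of_deriv he P.isOpen_bonded hbo hw.diff_psi.2 (hpow.psi p habs)
  have psi1 := holderNearZero_of_deriv hd' P.isOpen_crack hcr hw.diff_psi1.1
    (atMostIntegrablePower_of_side hcr psi1_d)
  have psi2 := holderNearZero_of_deriv hd' P.isOpen_crack hcr hw.diff_psi2.1
    (atMostIntegrablePower_of_side hcr psi2_d)
  have psi := holderNearZero_of_deriv he P.isOpen_bonded hbo hw.diff_psi.1
    (atMostIntegrablePower_of_side hbo psi_d)
  -- Seen along either ray, the density is Hölder ahead of and behind the tip, with the roles of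
  -- crack and bonded part exchanged.
  have pv21p_d : LogHolderNearZero fun t => cauchyPV (P.u21p w) (p + d * t) :=
    logHolder_cauchyPV hd' hed hl (fun t ht => hw.pv_u21p _ (ncr t ht))
      (psi1.congr (gin' _ _)) (psi.congr (gout' _ _))
  have pv21p_e : LogHolderNearZero fun t => cauchyPV (P.u21p w) (p + e * t) :=
    logHolder_cauchyPV he hd hl (fun t ht => hw.pv_u21p _ (nbo t ht))
      (psi.congr (gout' _ _)) (psi1.congr (gin' _ _))
  have pv21m_d : LogHolderNearZero fun t => cauchyPV (P.u21m w) (p + d * t) :=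
    logHolder_cauchyPV hd' hed hl (fun t ht => hw.pv_u21m _ (ncr t ht))
      (psi2.congr (gin' _ _)) (psi.congr (gout' _ _))
  have pv21m_e : LogHolderNearZero fun t => cauchyPV (P.u21m w) (p + e * t) :=
    logHolder_cauchyPV he hd hl (fun t ht => hw.pv_u21m _ (nbo t ht))
      (psi.congr (gout' _ _)) (psi2.congr (gin' _ _))
  have mIcc : ∀ t ∈ Set.Ioc 0 P.l, p + d * t ∈ Set.Icc (-P.l) P.l := fun t ht =>
    abs_le.1 (le_of_lt (mcr t ht))
  have gp : HolderNearZero fun t => P.gp (p + d * t) := by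
    obtain ⟨C, s, hs, h⟩ := hP.gp_holder
    exact holderNearZero_of_holderOnWith hd' hs hl mIcc h
  have gm : HolderNearZero fun t => P.gm (p + d * t) := by
    obtain ⟨C, s, hs, h⟩ := hP.gm_holder
    exact holderNearZero_of_holderOnWith hd' hs hl mIcc h
  -- A continuous load has a limit at the tip, which is all that the shear balance requires.
  have load : ∀ f : ℝ → ℝ, ContinuousOn f (Set.Icc (-P.l) P.l) →
      LogSqNearZero fun t => f (p + d * t) := by
    intro f hf
    have h1 : Tendsto (fun t : ℝ => p + d * t) (𝓝[>] 0) (𝓝[P.crack] p) := hcr ▸ tendsto_map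
    have h2 : Tendsto f (𝓝[P.crack] p) (𝓝 (f p)) :=
      (hf p (abs_le.1 habs.le)).mono_left (nhdsWithin_mono _ fun x hx => abs_le.1 (le_of_lt hx))
    exact .of_tendsto (h2.comp h1)
  have hα1 := hP.upper.alpha_pos.ne'
  have hα2 := hP.lower.alpha_pos.ne'
  have hα := sub_ne_zero.2 hP.alpha_ne
  -- The normal balance on the bank is solved for `φ₁`, which is possible because `α₁ > 0`.
  have phi1 : LogHolderNearZero fun t => w.phi1 (p + d * t) := by
    refine (((pv21p_d.const_mul P.upper.beta).add (.of_holder (((psi1_d.const_mul P.gamma0p).sub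
      gp).add (HolderNearZero.const P.sigma)))).const_mul P.upper.alpha⁻¹).congr ?_
    filter_upwards [hIoc] with t ht
    have h1 := hw.normal_upper _ (mcr t ht)
    rw [sigma22p, u11p, gin _ _ t ht] at h1
    field_simp
    linarith
  have phi2 : LogHolderNearZero fun t => w.phi2 (p + d * t) := by
    refine (((pv21m_d.const_mul (-P.lower.beta)).add (.of_holder
      (((psi2_d.const_mul (-P.gamma0m)).sub gm).add (HolderNearZero.const P.sigma)))).const_mul
        P.lower.alpha⁻¹).congr ?_
    filter_upwards [hIoc] with t ht
    have h1 := hw.normal_lower _ (mcr t ht)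
    rw [sigma22m, u11m, gin _ _ t ht] at h1
    field_simp
    linarith
  -- On the bonded part both sides share the same `φ`, so the jump of the normal stresses contains
  -- it with coefficient `α₁ - α₂`; here `α₁ ≠ α₂` is indispensable to the division.
  have phi : LogHolderNearZero fun t => w.phi (p + e * t) := by
    refine ((((pv21p_e.const_mul P.upper.beta).add (pv21m_e.const_mul P.lower.beta)).add
      (.of_holder (psi_d.const_mul P.gamma0i))).const_mul
        (P.upper.alpha - P.lower.alpha)⁻¹).congr ?_
    filter_upwards [hIoc] with t ht
    have h1 := hw.normal_bonded _ (mbo t ht)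
    rw [sigma22p, sigma22m, u11p, u11m, gout _ _ t ht, gout _ _ t ht] at h1
    field_simp
    linarith
  have pv11p_d : LogSqNearZero fun t => cauchyPV (P.u11p w) (p + d * t) :=
    logSq_cauchyPV hd' hed hl (fun t ht => hw.pv_u11p _ (ncr t ht))
      (phi1.congr (gin' _ _)) (phi.congr (gout' _ _))
  have pv11p_e : LogSqNearZero fun t => cauchyPV (P.u11p w) (p + e * t) :=
    logSq_cauchyPV he hd hl (fun t ht => hw.pv_u11p _ (nbo t ht))
      (phi.congr (gout' _ _)) (phi1.congr (gin' _ _))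
  have pv11m_d : LogSqNearZero fun t => cauchyPV (P.u11m w) (p + d * t) :=
    logSq_cauchyPV hd' hed hl (fun t ht => hw.pv_u11m _ (ncr t ht))
      (phi2.congr (gin' _ _)) (phi.congr (gout' _ _))
  have pv11m_e : LogSqNearZero fun t => cauchyPV (P.u11m w) (p + e * t) :=
    logSq_cauchyPV he hd hl (fun t ht => hw.pv_u11m _ (nbo t ht))
      (phi.congr (gout' _ _)) (phi2.congr (gin' _ _))
  have ofH : ∀ {F : ℝ → ℝ}, HolderNearZero F → LogSqNearZero F := fun h =>
    .of_logHolder (.of_holder h)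
  have s12p_d : LogSqNearZero fun t => P.totalSigma12p w (p + d * t) := by
    refine (((ofH (psi1.congr (gin' w.psi1 w.psi))).const_mul P.upper.alpha).add
      (pv11p_d.const_mul P.upper.beta)).add (ofH (HolderNearZero.const P.tau))
  have s12p_e : LogSqNearZero fun t => P.totalSigma12p w (p + e * t) := by
    refine (((ofH (psi.congr (gout' w.psi1 w.psi))).const_mul P.upper.alpha).add
      (pv11p_e.const_mul P.upper.beta)).add (ofH (HolderNearZero.const P.tau))
  have s12m_d : LogSqNearZero fun t => P.totalSigma12m w (p + d * t) := by
    refine ((((ofH (psi2.congr (gin' w.psi2 w.psi))).const_mul P.lower.alpha).add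
      (pv11m_d.const_mul (-P.lower.beta))).add (ofH (HolderNearZero.const P.tau))).congr ?_
    exact Eventually.of_forall fun t => by
      simp only [totalSigma12m, sigma12m, u21m]; ring
  have s12m_e : LogSqNearZero fun t => P.totalSigma12m w (p + e * t) := by
    refine ((((ofH (psi.congr (gout' w.psi2 w.psi))).const_mul P.lower.alpha).add
      (pv11m_e.const_mul (-P.lower.beta))).add (ofH (HolderNearZero.const P.tau))).congr ?_
    exact Eventually.of_forall fun t => by
      simp only [totalSigma12m, sigma12m, u21m]; ring
  refine ⟨phi1, phi2, phi, psi1, psi2, psi, psi1_d, psi2_d, psi_d, ?_, ?_, ?_, s12p_d, s12m_d,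
    s12p_e, s12m_e, ?_, ?_, ?_, ?_, ?_⟩
  -- With the shear stresses known, the shear balances are solved for the second derivatives by
  -- dividing by the coefficients `γ₁`.
  · refine ((s12p_d.add ((load _ hP.fp_cont).const_mul (-1))).const_mul P.gamma1p⁻¹).congr ?_
    filter_upwards [hIoc] with t ht
    have h1 := hw.shear_upper _ (mcr t ht)
    rw [totalSigma12p, h1]
    field_simp
    ring
  · refine ((s12m_d.add ((load _ hP.fm_cont).const_mul (-1))).const_mul (-P.gamma1m⁻¹)).congr ?_
    filter_upwards [hIoc] with t ht
    have h1 := hw.shear_lower _ (mcr t ht)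
    rw [totalSigma12m, h1]
    field_simp
    ring
  · refine ((s12p_e.add (s12m_e.const_mul (-1))).const_mul P.gamma1i⁻¹).congr ?_
    filter_upwards [hIoc] with t ht
    have h1 := hw.shear_bonded _ (mbo t ht)
    rw [totalSigma12p, totalSigma12m]
    field_simp
    linarith
  · refine ((psi1_d.const_mul (-P.gamma0p)).add gp).congr ?_
    filter_upwards [hIoc] with t ht using (hw.normal_upper _ (mcr t ht)).symm
  · refine ((psi2_d.const_mul P.gamma0m).add gm).congr ?_
    filter_upwards [hIoc] with t ht using (hw.normal_lower _ (mcr t ht)).symm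
  · refine (psi_d.const_mul (-P.gamma0i)).congr ?_
    filter_upwards [hIoc] with t ht
    rw [totalSigma22p, totalSigma22m, add_sub_add_right_eq_sub, hw.normal_bonded _ (mbo t ht)]
  -- On the bonded part only the jump of the normal stress is tied to `ψ'`; each single value keeps
  -- the logarithms of `φ` and of the principal value.
  · exact (((phi.congr (gout' w.phi1 w.phi)).const_mul (-P.upper.alpha)).add
      (pv21p_e.const_mul P.upper.beta)).add (.of_holder (HolderNearZero.const P.sigma))
  · refine ((((phi.congr (gout' w.phi2 w.phi)).const_mul (-P.lower.alpha)).add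
      (pv21m_e.const_mul (-P.lower.beta))).add (.of_holder (HolderNearZero.const P.sigma))).congr ?_
    exact Eventually.of_forall fun t => by
      simp only [totalSigma22m, sigma22m, u11m]; ring

/-! ### From germs along the two rays to the statements at the tip -/

theorem TipRegular.noPowerSingularity {w : Unknowns} (h : TipRegular P w p e d)
    (he : e = 1 ∨ e = -1) (hd : d = 1 ∨ d = -1)
    (hcr : 𝓝[P.crack] p = map (fun t => p + d * t) (𝓝[>] 0))
    (hbo : 𝓝[P.bonded] p = map (fun t => p + e * t) (𝓝[>] 0)) : P.NoPowerSingularity w p where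
  phi1 := not_hasPowerSingularity_of_side hd hcr (.of_logHolder h.phi1)
  phi2 := not_hasPowerSingularity_of_side hd hcr (.of_logHolder h.phi2)
  phi := not_hasPowerSingularity_of_side he hbo (.of_logHolder h.phi)
  psi1 := not_hasPowerSingularity_of_side hd hcr (.of_logHolder (.of_holder h.psi1))
  psi2 := not_hasPowerSingularity_of_side hd hcr (.of_logHolder (.of_holder h.psi2))
  psi := not_hasPowerSingularity_of_side he hbo (.of_logHolder (.of_holder h.psi))
  psi1_dd := not_hasPowerSingularity_of_side hd hcr h.psi1_dd
  psi2_dd := not_hasPowerSingularity_of_side hd hcr h.psi2_dd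
  psi_dd := not_hasPowerSingularity_of_side he hbo h.psi_dd
  sigma12p_crack := not_hasPowerSingularity_of_side hd hcr h.sigma12p_crack
  sigma12m_crack := not_hasPowerSingularity_of_side hd hcr h.sigma12m_crack
  sigma22p_crack :=
    not_hasPowerSingularity_of_side hd hcr (.of_logHolder (.of_holder h.sigma22p_crack))
  sigma22m_crack :=
    not_hasPowerSingularity_of_side hd hcr (.of_logHolder (.of_holder h.sigma22m_crack))
  sigma12p_bonded := not_hasPowerSingularity_of_side he hbo h.sigma12p_bonded
  sigma12m_bonded := not_hasPowerSingularity_of_side he hbo h.sigma12m_bonded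
  sigma22p_bonded := not_hasPowerSingularity_of_side he hbo (.of_logHolder h.sigma22p_bonded)
  sigma22m_bonded := not_hasPowerSingularity_of_side he hbo (.of_logHolder h.sigma22m_bonded)

theorem TipRegular.atMostLogarithmic {w : Unknowns} (h : TipRegular P w p e d)
    (he : e = 1 ∨ e = -1) (hd : d = 1 ∨ d = -1)
    (hcr : 𝓝[P.crack] p = map (fun t => p + d * t) (𝓝[>] 0))
    (hbo : 𝓝[P.bonded] p = map (fun t => p + e * t) (𝓝[>] 0)) : P.AtMostLogarithmic w p where
  phi1 := hasLogExpansion_of_side hd hcr h.phi1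
  phi2 := hasLogExpansion_of_side hd hcr h.phi2
  phi := hasLogExpansion_of_side he hbo h.phi
  psi1_dd := hasLogSqExpansion_of_side hd hcr h.psi1_dd
  psi2_dd := hasLogSqExpansion_of_side hd hcr h.psi2_dd
  psi_dd := hasLogSqExpansion_of_side he hbo h.psi_dd
  psi1 := boundedAlong_of_side hcr h.psi1
  psi2 := boundedAlong_of_side hcr h.psi2
  psi := boundedAlong_of_side hbo h.psi
  psi1_d := boundedAlong_of_side hcr h.psi1_d
  psi2_d := boundedAlong_of_side hcr h.psi2_d
  psi_d := boundedAlong_of_side hbo h.psi_d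
  sigma12p_crack := hasLogSqExpansion_of_side hd hcr h.sigma12p_crack
  sigma12m_crack := hasLogSqExpansion_of_side hd hcr h.sigma12m_crack
  sigma12p_bonded := hasLogSqExpansion_of_side he hbo h.sigma12p_bonded
  sigma12m_bonded := hasLogSqExpansion_of_side he hbo h.sigma12m_bonded
  sigma22p_crack := boundedAlong_of_side hcr h.sigma22p_crack
  sigma22m_crack := boundedAlong_of_side hcr h.sigma22m_crack
  sigma22_jump_bonded := boundedAlong_of_side
    (F := fun x => P.totalSigma22p w x - P.totalSigma22m w x) hbo h.sigma22_jump_bonded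
  sigma22p_bonded := hasLogExpansion_of_side he hbo h.sigma22p_bonded
  sigma22m_bonded := hasLogExpansion_of_side he hbo h.sigma22m_bonded

end Problem

end InterfaceCrack

end

theorem mainTheorem1 (P : InterfaceCrack.Problem) (hP : P.Admissible)
    (hγp : P.gamma1p ≠ 0) (hγm : P.gamma1m ≠ 0) (hγi : P.gamma1i ≠ 0)
    (w : InterfaceCrack.Unknowns) (hw : P.IsSolution w) (hpow : P.AtMostPowerAtTips w)
    (p : ℝ) (hp : |p| = P.l) :
    P.NoPowerSingularity w p ∧ P.AtMostLogarithmic w p := by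
  -- The sign `e` of the tip is the outward direction, along the bonded part; the crack leaves the
  -- tip in direction `-e`.
  obtain ⟨e, he, hpe⟩ : ∃ e : ℝ, (e = 1 ∨ e = -1) ∧ p = e * P.l := by
    rcases (abs_eq hP.l_pos.le).1 hp with h | h
    · exact ⟨1, Or.inl rfl, by simpa using h⟩
    · exact ⟨-1, Or.inr rfl, by simpa using h⟩
  have hd : -e = 1 ∨ -e = -1 := by rcases he with rfl | rfl <;> simp
  have h := InterfaceCrack.Problem.tipRegular hP hγp hγm hγi hw hpow he rfl hpe
  have hcr := InterfaceCrack.Problem.nhdsWithin_crack hP.l_pos he rfl hpe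
  have hbo := InterfaceCrack.Problem.nhdsWithin_bonded hP.l_pos he hpe
  exact ⟨h.noPowerSingularity he hd hcr hbo, h.atMostLogarithmic he hd hcr hbo⟩
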